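/- Let $$P_3=1-x+\frac{x^3}{7},\qquad Q_3=\Bigl(1-\frac{3x^2}{7}\Bigr)\Bigl(1-x+\frac{2x^2}{7}\Bigr)\Bigl(1-\frac{5x}{4}+\frac{11x^2}{28}\Bigr),$$ $$\Psi_3=\frac{x^3(3x^2-7)^3(2x^2-7x+7)^3(11x^2-35x+28)^3}{1728\,(x^3-7x+7)^7},\qquad S=\sqrt{7-\tfrac{21}{4}x^2+x^4},$$ $$Y_0=\sqrt{1-\tfrac{2x}{3}},\qquad Y_1=\Bigl(\frac{21-8x^2+8S}{21+8\sqrt7}\Bigr)^{1/4},\qquad Y_2=\Bigl(\frac{21-8x^2-8S}{21-8\sqrt7}\Bigr)^{1/4},$$ $$W_1=\frac{2x^2-3x+2S}{2\sqrt7},\qquad W_2=\frac{3x-2x^2+2S}{2\sqrt7},$$ where $x$ is a complex variable near $0$ and all radicals are taken with principal branches (so $S=\sqrt7$, $Y_i=1$ and $W_i=1$ at $x=0$). Then for all complex $x$ in a neighborhood of $0$ the hypergeometric series below converge and $$\sqrt{P_3}\;{}_3F_2\!\left({-\frac1{14},\frac3{14},\frac5{14}\atop \frac13,\frac23}\,\Big|\,\Psi_3\right)=\frac{3+\sqrt7}{6}\,W_1Y_1+\frac{3-\sqrt7}{6}\,W_2Y_2,$$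 $$x\,Q_3P_3^{-11/6}\;{}_3F_2\!\left({\frac{11}{42},\frac{23}{42},\frac{29}{42}\atop \frac23,\frac43}\,\Big|\,\Psi_3\right)=\frac12\,xY_0-\frac{\sqrt7}{6}\,W_1Y_1+\frac{\sqrt7}{6}\,W_2Y_2,$$ $$x^2Q_3^2P_3^{-25/6}\;{}_3F_2\!\left({\frac{25}{42},\frac{37}{42},\frac{43}{42}\atop \frac43,\frac53}\,\Big|\,\Psi_3\right)=6\,xY_0+2\sqrt7\,W_1Y_1-2\sqrt7\,W_2Y_2.$$ Moreover, near $x=0$ the functions $xY_0,\ W_1Y_1,\ W_2Y_2$ form a basis of solutions of the third order linear differential equation for $Y(x)$ obtained from the hypergeometric equation $$\Bigl(z\tfrac{d}{dz}-\tfrac1{14}\Bigr)\Bigl(z\tfrac{d}{dz}+\tfrac3{14}\Bigr)\Bigl(z\tfrac{d}{dz}+\tfrac5{14}\Bigr)y=\tfrac{d}{dz}\Bigl(z\tfrac{d}{dz}-\tfrac23\Bigr)\Bigl(z\tfrac{d}{dz}-\tfrac13\Bigr)y$$ by the pull-back $z=\Psi_3(x)$, $Y(x)=\sqrt{P_3(x)}\;y(\Psi_3(x))$: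 there is $r>0$ such that for every non-empty connected open set $U\subseteq\{|x|<r\}$ these three functions are linearly independent on $U$ and the holomorphic solutions on $U$ are exactly their $\mathbb{C}$-linear combinations. (A holomorphic function on $U$ is called a solution if it satisfies the pulled-back equation at the points of $U$ where $\Psi_3'\neq0$ and $P_3\neq0$.) -/

import Mathlib

open Filter Topology

noncomputable section

namespace Darboux3B

/-- Coefficient of `z ^ n` in the generalized hypergeometric series `₃F₂(a₁,a₂,a₃; b₁,b₂; z)`:
`(a₁)ₙ (a₂)ₙ (a₃)ₙ / ((b₁)ₙ (b₂)ₙ n!)` with rising Pochhammer symbols. -/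
def hyp32Coeff (a₁ a₂ a₃ b₁ b₂ : ℂ) (n : ℕ) : ℂ :=
  ((ascPochhammer ℂ n).eval a₁ * (ascPochhammer ℂ n).eval a₂ * (ascPochhammer ℂ n).eval a₃) /
    ((ascPochhammer ℂ n).eval b₁ * (ascPochhammer ℂ n).eval b₂ * (n.factorial : ℂ))

/-- The generalized hypergeometric function `₃F₂(a₁,a₂,a₃; b₁,b₂; z)` as the sum of its series. -/
def hyp32 (a₁ a₂ a₃ b₁ b₂ z : ℂ) : ℂ :=
  ∑' n : ℕ, hyp32Coeff a₁ a₂ a₃ b₁ b₂ n * z ^ n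

/-- The derivation `d/dz` written in the variable `x`, where `z = φ x`,
namely `(1 / φ'(x)) d/dx`. -/
def pullDeriv (φ f : ℂ → ℂ) : ℂ → ℂ := fun x => deriv f x / deriv φ x

/-- The operator `z d/dz + a` written in the variable `x`, where `z = φ x`. -/
def pullEuler (φ : ℂ → ℂ) (a : ℂ) (f : ℂ → ℂ) : ℂ → ℂ :=
  fun x => φ x * pullDeriv φ f x + a * f x

/-- The hypergeometric differential equation
`(z d/dz + a₁)(z d/dz + a₂)(z d/dz + a₃) y = d/dz (z d/dz + b₁ - 1)(z d/dz + b₂ - 1) y`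
after the substitution `z = φ x`, at the point `x`, for the function `u x = y (φ x)`.
For `φ = id` this is the hypergeometric equation itself. -/
def HypEqAt (a₁ a₂ a₃ b₁ b₂ : ℂ) (φ u : ℂ → ℂ) (x : ℂ) : Prop :=
  pullEuler φ a₁ (pullEuler φ a₂ (pullEuler φ a₃ u)) x =
    pullDeriv φ (pullEuler φ (b₁ - 1) (pullEuler φ (b₂ - 1) u)) x

/-- `Y` is a holomorphic solution on `U` of the pull-back, under
`z ↦ φ x`, `y(z) ↦ Y(x) = θ x * y (φ x)`, of the hypergeometric equation with parameters
`a₁, a₂, a₃; b₁, b₂`.  The substitution makes sense wherever `φ' ≠ 0` and `θ ≠ 0`, and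
there the equation is imposed on `Y / θ`. -/
def IsPullbackSolutionOn (a₁ a₂ a₃ b₁ b₂ : ℂ) (θ φ : ℂ → ℂ) (U : Set ℂ) (Y : ℂ → ℂ) : Prop :=
  DifferentiableOn ℂ Y U ∧
    ∀ x ∈ U, deriv φ x ≠ 0 → θ x ≠ 0 →
      HypEqAt a₁ a₂ a₃ b₁ b₂ φ (fun t => Y t / θ t) x

/-- `B` is, near `x = 0`, a basis of solutions of the pulled-back hypergeometric equation:
on every non-empty connected open subset `U` of some disk around `0`, the holomorphic solutions
on `U` are exactly the linear combinations of the functions `B i`,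
and these are linearly independent on `U`. -/
def IsPullbackSolutionBasisNearZero (a₁ a₂ a₃ b₁ b₂ : ℂ) (θ φ : ℂ → ℂ)
    (B : Fin 3 → ℂ → ℂ) : Prop :=
  ∃ r : ℝ, 0 < r ∧ ∀ U : Set ℂ, IsOpen U → IsConnected U → U ⊆ Metric.ball 0 r →
    (∀ Y : ℂ → ℂ, IsPullbackSolutionOn a₁ a₂ a₃ b₁ b₂ θ φ U Y ↔
      ∃ c : Fin 3 → ℂ, ∀ x ∈ U, Y x = ∑ i, c i * B i x) ∧
    (∀ c : Fin 3 → ℂ, (∀ x ∈ U, ∑ i, c i * B i x = 0) → c = 0)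

/-- The positive square root of `7`. -/
def s7 : ℂ := ((Real.sqrt 7 : ℝ) : ℂ)

/-- The covering `Ψ₃` of degree 21. -/
def Psi3 (x : ℂ) : ℂ :=
  (x ^ 3 * (3 * x ^ 2 - 7) ^ 3 * (2 * x ^ 2 - 7 * x + 7) ^ 3 * (11 * x ^ 2 - 35 * x + 28) ^ 3) /
    (1728 * (x ^ 3 - 7 * x + 7) ^ 7)

def P3 (x : ℂ) : ℂ := 1 - x + x ^ 3 / 7

def Q3 (x : ℂ) : ℂ :=
  (1 - 3 * x ^ 2 / 7) * (1 - x + 2 * x ^ 2 / 7) * (1 - 5 * x / 4 + 11 * x ^ 2 / 28)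

/-- `√(7 - 21 x² / 4 + x⁴)`, the branch with value `√7` at `x = 0`
(all radicals below are principal values as well). -/
def S (x : ℂ) : ℂ := (7 - 21 / 4 * x ^ 2 + x ^ 4) ^ (1 / 2 : ℂ)

def Y0 (x : ℂ) : ℂ := (1 - 2 * x / 3) ^ (1 / 2 : ℂ)

def Y1 (x : ℂ) : ℂ := ((21 - 8 * x ^ 2 + 8 * S x) / (21 + 8 * s7)) ^ (1 / 4 : ℂ)

def Y2 (x : ℂ) : ℂ := ((21 - 8 * x ^ 2 - 8 * S x) / (21 - 8 * s7)) ^ (1 / 4 : ℂ)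

def W1 (x : ℂ) : ℂ := (2 * x ^ 2 - 3 * x + 2 * S x) / (2 * s7)

def W2 (x : ℂ) : ℂ := (3 * x - 2 * x ^ 2 + 2 * S x) / (2 * s7)

end Darboux3B

/-!
Substituting `z = Ψ₃(x)` in a third order hypergeometric equation and multiplying its solutions by
a prefactor gives another third order linear equation, so both sides of each identity can be
recognised as solutions of one linear equation that agree to second order at `0`.

Two factorizations control the singularities: `Ψ₃` has the cube of a polynomial `A` in its
numerator, `Ψ₃ - 1` is a multiple of the square of a polynomial `R`, and `Ψ₃' / Ψ₃` is
`49 R / (x A P)`, where `P` is the denominator of `Ψ₃` up to the seventh power. The local exponents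
of the hypergeometric equation are such that the pulled-back equation has no singularity at `0`, at
the zeros of `A` or at those of `R`; near `0` its solution space is three-dimensional.

The radicals in each of the algebraic functions form a vector `v` with `v' = (L / D) v` for a
polynomial matrix `L` and a polynomial `D`, so all derivatives are rational combinations of its
components and the pulled-back equation reduces to polynomial identities. The Wronskian
of the three functions at `0` is `1 / √7`, so they form a basis. On the hypergeometric side, the
prefactors `x Q₃ P₃ ^ (-11 / 6)` and `(x Q₃) ^ 2 P₃ ^ (-25 / 6)` are, up to the factor `√P₃` and
constants, the powers `Ψ₃ ^ (1 / 3)` and `Ψ₃ ^ (2 / 3)` that turn the two other local solutions at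
`z = 0` into power series, and since `Ψ₃ = O(x³)` only the prefactors contribute to the Taylor
polynomial of degree two.
-/

noncomputable section

namespace Darboux3B

open scoped Matrix
open Complex

section LinearODE

variable {n : ℕ}

/-- The homogeneous linear differential equation `a₀ y + a₁ y' + ⋯ + aₙ y⁽ⁿ⁾ = 0` at the
point `x`. -/
def IsSolutionAt (a : Fin (n + 1) → ℂ → ℂ) (y : ℂ → ℂ) (x : ℂ) : Prop :=
  ∑ i, a i x * iteratedDeriv i y x = 0

theorem isSolutionAt_three_iff {a : Fin 4 → ℂ → ℂ} {y : ℂ → ℂ} {x : ℂ} :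
    IsSolutionAt a y x ↔ a 0 x * iteratedDeriv 0 y x + a 1 x * iteratedDeriv 1 y x +
      a 2 x * iteratedDeriv 2 y x + a 3 x * iteratedDeriv 3 y x = 0 := by
  rw [IsSolutionAt, Fin.sum_univ_four]
  rfl

/-- The Wronskian matrix, with the derivatives of order `i` in the row `i`. -/
def wronskianMatrix (u : Fin n → ℂ → ℂ) (x : ℂ) : Matrix (Fin n) (Fin n) ℂ :=
  Matrix.of fun i j => iteratedDeriv i (u j) x

theorem analyticAt_iteratedDeriv {f : ℂ → ℂ} {x : ℂ} (hf : AnalyticAt ℂ f x) (k : ℕ) :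
    AnalyticAt ℂ (iteratedDeriv k f) x := by
  rw [iteratedDeriv_eq_iterate]
  exact hf.iterated_deriv k

theorem iteratedDeriv_linearCombination {ι : Type*} [Fintype ι] {u : ι → ℂ → ℂ} {x : ℂ}
    (hu : ∀ j, AnalyticAt ℂ (u j) x) (c : ι → ℂ) (k : ℕ) :
    iteratedDeriv k (fun t => ∑ j, c j * u j t) x = ∑ j, c j * iteratedDeriv k (u j) x := by
  rw [iteratedDeriv_fun_sum fun j _ => (analyticAt_const.fun_mul (hu j)).contDiffAt]
  simp only [iteratedDeriv_const_mul_field]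

theorem iteratedDeriv_mul_of_le_analyticOrderAt {f g : ℂ → ℂ} {x : ℂ}
    (hf : AnalyticAt ℂ f x) (hg : AnalyticAt ℂ g x)
    (hn : n ≤ analyticOrderAt (fun t => g t - 1) x) {i : ℕ} (hi : i < n) :
    iteratedDeriv i (fun t => f t * g t) x = iteratedDeriv i f x := by
  have hg₁ : AnalyticAt ℂ (fun t => g t - 1) x := hg.fun_sub analyticAt_const
  have hord : n ≤ analyticOrderAt (f * fun t => g t - 1) x := by
    rw [analyticOrderAt_mul hf hg₁]
    exact hn.trans le_add_self
  have h₀ := (natCast_le_analyticOrderAt_iff_iteratedDeriv_eq_zero (hf.mul hg₁)).1 hord i hi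
  have hsplit : (fun t => f t * g t) = f + f * fun t => g t - 1 := by
    ext t
    simp only [Pi.add_apply, Pi.mul_apply]
    ring
  rw [hsplit, iteratedDeriv_add hf.contDiffAt (hf.mul hg₁).contDiffAt, h₀, add_zero]

theorem IsSolutionAt.const_mul {a : Fin (n + 1) → ℂ → ℂ} {y : ℂ → ℂ} {x : ℂ}
    (hy : IsSolutionAt a y x) (c : ℂ) : IsSolutionAt a (fun t => c * y t) x := by
  simp only [IsSolutionAt, iteratedDeriv_const_mul_field, mul_left_comm _ c, ← Finset.mul_sum]
  rw [hy, mul_zero]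

theorem isSolutionAt_congr {a : Fin (n + 1) → ℂ → ℂ} {y z : ℂ → ℂ} {x : ℂ} (h : y =ᶠ[𝓝 x] z) :
    IsSolutionAt a y x ↔ IsSolutionAt a z x := by
  simp only [IsSolutionAt, h.iteratedDeriv_eq]

theorem isSolutionAt_of_eventually_nhdsNE {a : Fin (n + 1) → ℂ → ℂ} {y : ℂ → ℂ} {x : ℂ}
    (ha : ∀ i, ContinuousAt (a i) x) (hy : AnalyticAt ℂ y x)
    (h : ∀ᶠ t in 𝓝[≠] x, IsSolutionAt a y t) : IsSolutionAt a y x := by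
  have hcont : ContinuousAt (fun t => ∑ i, a i t * iteratedDeriv i y t) x :=
    tendsto_finsetSum _ fun i _ => (ha i).mul (analyticAt_iteratedDeriv hy i).continuousAt
  exact ((hcont.eventuallyEq_nhds_iff_eventuallyEq_nhdsNE continuousAt_const).1 h).self_of_nhds

theorem IsSolutionAt.linearCombination {a : Fin (n + 1) → ℂ → ℂ} {ι : Type*} [Fintype ι]
    {u : ι → ℂ → ℂ} {x : ℂ} (hu : ∀ j, AnalyticAt ℂ (u j) x)
    (hsol : ∀ j, IsSolutionAt a (u j) x) (c : ι → ℂ) :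
    IsSolutionAt a (fun t => ∑ j, c j * u j t) x := by
  simp only [IsSolutionAt] at hsol ⊢
  simp only [iteratedDeriv_linearCombination hu, Finset.mul_sum]
  rw [Finset.sum_comm]
  refine Finset.sum_eq_zero fun j _ => ?_
  simp only [mul_left_comm _ (c j), ← Finset.mul_sum, hsol j, mul_zero]

theorem wronskianMatrix_mulVec {u : Fin n → ℂ → ℂ} {x : ℂ} (hu : ∀ j, AnalyticAt ℂ (u j) x)
    (c : Fin n → ℂ) :
    wronskianMatrix u x *ᵥ c = fun i : Fin n => iteratedDeriv i (fun t => ∑ j, c j * u j t) x := by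
  ext i
  rw [iteratedDeriv_linearCombination hu]
  simp only [Matrix.mulVec, dotProduct, wronskianMatrix, Matrix.of_apply, mul_comm]

theorem eq_zero_of_linearCombination_eqOn_zero {U : Set ℂ} (hU : IsOpen U) {u : Fin n → ℂ → ℂ}
    {x : ℂ} (hx : x ∈ U) (hu : ∀ j, AnalyticAt ℂ (u j) x) (hW : (wronskianMatrix u x).det ≠ 0)
    {c : Fin n → ℂ} (hc : U.EqOn (fun t => ∑ j, c j * u j t) 0) : c = 0 := by
  refine Matrix.eq_zero_of_mulVec_eq_zero hW ?_
  rw [wronskianMatrix_mulVec hu]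
  ext i
  simpa using hc.iteratedDeriv_of_isOpen hU i hx

theorem differentiableAt_det {M : ℂ → Matrix (Fin n) (Fin n) ℂ} {x : ℂ}
    (hM : ∀ i j, DifferentiableAt ℂ (fun t => M t i j) x) :
    DifferentiableAt ℂ (fun t => (M t).det) x := by
  simp only [Matrix.det_apply']
  fun_prop

theorem differentiableAt_cramer {M : ℂ → Matrix (Fin n) (Fin n) ℂ} {b : ℂ → Fin n → ℂ} {x : ℂ}
    (hM : ∀ i j, DifferentiableAt ℂ (fun t => M t i j) x)
    (hb : ∀ i, DifferentiableAt ℂ (fun t => b t i) x) (j : Fin n) :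
    DifferentiableAt ℂ (fun t => (M t).cramer (b t) j) x := by
  simp only [Matrix.cramer_apply]
  refine differentiableAt_det fun i k => ?_
  simp only [Matrix.updateCol_apply]
  split_ifs
  exacts [hb i, hM i k]

theorem differentiableAt_wronskianMatrix {u : Fin n → ℂ → ℂ} {x : ℂ}
    (hu : ∀ j, AnalyticAt ℂ (u j) x) (i j : Fin n) :
    DifferentiableAt ℂ (fun t => wronskianMatrix u t i j) x :=
  (analyticAt_iteratedDeriv (hu j) i).differentiableAt

/-- The coordinates of the jet of `y` in the jets of the functions `u j`. -/
def jetCoord (u : Fin n → ℂ → ℂ) (y : ℂ → ℂ) (j : Fin n) (x : ℂ) : ℂ :=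
  (wronskianMatrix u x).cramer (fun i => iteratedDeriv i y x) j / (wronskianMatrix u x).det

theorem differentiableAt_jetCoord {u : Fin n → ℂ → ℂ} {y : ℂ → ℂ} {x : ℂ}
    (hu : ∀ j, AnalyticAt ℂ (u j) x) (hy : AnalyticAt ℂ y x)
    (hW : (wronskianMatrix u x).det ≠ 0) (j : Fin n) :
    DifferentiableAt ℂ (jetCoord u y j) x := by
  have hM := differentiableAt_wronskianMatrix hu
  have hb (i : Fin n) := (analyticAt_iteratedDeriv hy i).differentiableAt
  exact (differentiableAt_cramer hM hb j).fun_div (differentiableAt_det hM) hW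

theorem sum_jetCoord_mul_iteratedDeriv {u : Fin n → ℂ → ℂ} {y : ℂ → ℂ} {x : ℂ}
    (hW : (wronskianMatrix u x).det ≠ 0) (i : Fin n) :
    ∑ j, jetCoord u y j x * iteratedDeriv i (u j) x = iteratedDeriv i y x := by
  have h := congrFun ((wronskianMatrix u x).mulVec_cramer fun i => iteratedDeriv i y x) i
  simp only [Matrix.mulVec, dotProduct, wronskianMatrix, Matrix.of_apply, Pi.smul_apply,
    smul_eq_mul] at h
  simp only [jetCoord, div_mul_eq_mul_div, ← Finset.sum_div]
  rw [div_eq_iff hW, mul_comm (iteratedDeriv _ y x), wronskianMatrix, ← h]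
  exact Finset.sum_congr rfl fun j _ => mul_comm _ _

theorem IsSolutionAt.sum_jetCoord_mul_iteratedDeriv {a : Fin (n + 1) → ℂ → ℂ}
    {u : Fin n → ℂ → ℂ} {y : ℂ → ℂ} {x : ℂ} (hW : (wronskianMatrix u x).det ≠ 0)
    (ha : a (Fin.last n) x ≠ 0) (hu : ∀ j, IsSolutionAt a (u j) x) (hy : IsSolutionAt a y x)
    {i : ℕ} (hi : i ≤ n) :
    ∑ j, jetCoord u y j x * iteratedDeriv i (u j) x = iteratedDeriv i y x := by
  obtain hlt | rfl := hi.lt_or_eq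
  · exact Darboux3B.sum_jetCoord_mul_iteratedDeriv hW ⟨i, hlt⟩
  have hcomb : ∑ k, a k x * ∑ j, jetCoord u y j x * iteratedDeriv k (u j) x = 0 := by
    simp only [Finset.mul_sum]
    rw [Finset.sum_comm]
    refine Finset.sum_eq_zero fun j _ => ?_
    simp only [mul_left_comm _ (jetCoord u y j x), ← Finset.mul_sum]
    rw [hu j, mul_zero]
  rw [IsSolutionAt, ← hcomb, Fin.sum_univ_castSucc, Fin.sum_univ_castSucc] at hy
  simp only [Fin.val_castSucc, Darboux3B.sum_jetCoord_mul_iteratedDeriv hW] at hy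
  exact (mul_left_cancel₀ ha (add_left_cancel hy)).symm

theorem deriv_jetCoord_eq_zero {U : Set ℂ} (hU : IsOpen U)
    {u : Fin n → ℂ → ℂ} {y : ℂ → ℂ} (hu : ∀ j, AnalyticOnNhd ℂ (u j) U)
    (hy : AnalyticOnNhd ℂ y U) (hW : ∀ x ∈ U, (wronskianMatrix u x).det ≠ 0)
    (hsum : ∀ x ∈ U, ∀ i ≤ n,
      ∑ j, jetCoord u y j x * iteratedDeriv i (u j) x = iteratedDeriv i y x)
    {x : ℂ} (hx : x ∈ U) (j : Fin n) : deriv (jetCoord u y j) x = 0 := by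
  suffices h : wronskianMatrix u x *ᵥ (fun j => deriv (jetCoord u y j) x) = 0 from
    congrFun (Matrix.eq_zero_of_mulVec_eq_zero (hW x hx) h) j
  ext i
  have hv (j) : HasDerivAt (jetCoord u y j) (deriv (jetCoord u y j) x) x :=
    (differentiableAt_jetCoord (fun j => hu j x hx) (hy x hx) (hW x hx) j).hasDerivAt
  have hasDerivAt_iteratedDeriv {f : ℂ → ℂ} (hf : AnalyticOnNhd ℂ f U) :
      HasDerivAt (iteratedDeriv i f) (iteratedDeriv (i + 1) f x) x := by
    rw [iteratedDeriv_succ]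
    exact (analyticAt_iteratedDeriv (hf x hx) i).differentiableAt.hasDerivAt
  have hsum_deriv : HasDerivAt (iteratedDeriv i y)
      (∑ j, (deriv (jetCoord u y j) x * iteratedDeriv i (u j) x +
        jetCoord u y j x * iteratedDeriv (i + 1) (u j) x)) x :=
    (HasDerivAt.fun_sum fun j _ =>
      (hv j).mul (hasDerivAt_iteratedDeriv (hu j))).congr_of_eventuallyEq
        ((hU.eventually_mem hx).mono fun t ht => (hsum t ht i i.isLt.le).symm)
  have h := hsum_deriv.unique (hasDerivAt_iteratedDeriv hy)
  rw [Finset.sum_add_distrib, hsum x hx (i + 1) i.isLt, add_eq_right] at h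
  simpa only [Matrix.mulVec, dotProduct, wronskianMatrix, Matrix.of_apply, Pi.zero_apply,
    mul_comm] using h

/-- Variation of constants: the coordinates of the jet of a solution are locally constant. -/
theorem exists_eqOn_linearCombination {U : Set ℂ} (hU : IsOpen U) (hUc : IsPreconnected U)
    {a : Fin (n + 1) → ℂ → ℂ} {u : Fin n → ℂ → ℂ} {y : ℂ → ℂ}
    (hu : ∀ j, AnalyticOnNhd ℂ (u j) U) (hy : AnalyticOnNhd ℂ y U)
    (hW : ∀ x ∈ U, (wronskianMatrix u x).det ≠ 0) (ha : ∀ x ∈ U, a (Fin.last n) x ≠ 0)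
    (husol : ∀ x ∈ U, ∀ j, IsSolutionAt a (u j) x) (hysol : ∀ x ∈ U, IsSolutionAt a y x) :
    ∃ c : Fin n → ℂ, U.EqOn y fun x => ∑ j, c j * u j x := by
  have hsum (x) (hx : x ∈ U) (i) (hi : i ≤ n) :=
    (hysol x hx).sum_jetCoord_mul_iteratedDeriv (hW x hx) (ha x hx) (husol x hx) hi
  have hconst (j) : ∃ c, ∀ x ∈ U, jetCoord u y j x = c :=
    hU.exists_is_const_of_deriv_eq_zero hUc
      (fun x hx => (differentiableAt_jetCoord (fun j => hu j x hx) (hy x hx) (hW x hx)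
        j).differentiableWithinAt)
      fun x hx => deriv_jetCoord_eq_zero hU hu hy hW hsum hx j
  choose c hc using hconst
  refine ⟨c, fun x hx => ?_⟩
  simpa only [hc _ x hx, iteratedDeriv_zero] using (hsum x hx 0 n.zero_le).symm

theorem eqOn_linearCombination_of_iteratedDeriv_eq {U : Set ℂ} (hU : IsOpen U)
    (hUc : IsPreconnected U) {a : Fin (n + 1) → ℂ → ℂ} {u : Fin n → ℂ → ℂ} {y : ℂ → ℂ}
    (hu : ∀ j, AnalyticOnNhd ℂ (u j) U) (hy : AnalyticOnNhd ℂ y U)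
    (hW : ∀ x ∈ U, (wronskianMatrix u x).det ≠ 0) (ha : ∀ x ∈ U, a (Fin.last n) x ≠ 0)
    (husol : ∀ x ∈ U, ∀ j, IsSolutionAt a (u j) x) (hysol : ∀ x ∈ U, IsSolutionAt a y x)
    {x₀ : ℂ} (hx₀ : x₀ ∈ U) {c : Fin n → ℂ}
    (hc : ∀ i < n, iteratedDeriv i y x₀ = ∑ j, c j * iteratedDeriv i (u j) x₀) :
    U.EqOn y fun x => ∑ j, c j * u j x := by
  obtain ⟨d, hd⟩ := exists_eqOn_linearCombination hU hUc hu hy hW ha husol hysol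
  have hux₀ (j) : AnalyticAt ℂ (u j) x₀ := hu j x₀ hx₀
  suffices h : c = d by rwa [h]
  refine Matrix.mulVec_injective_of_isUnit
    ((Matrix.isUnit_iff_isUnit_det _).2 (hW x₀ hx₀).isUnit) ?_
  simp only [wronskianMatrix_mulVec hux₀]
  ext i
  rw [iteratedDeriv_linearCombination hux₀, ← hc i i.isLt, hd.iteratedDeriv_of_isOpen hU i hx₀]

end LinearODE

section PolynomialJets

variable {ι : Type*} [Fintype ι]

open Polynomial

/-- If `v' = (L / D) v` for a polynomial matrix `L` and a polynomial `D`, then the `k`-th derivative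
of `∑ i, p i * v i` is `(∑ i, q i * v i) / D ^ k` with `q = jetNumerator D L p k`. -/
def jetNumerator (D : ℂ[X]) (L : Matrix ι ι ℂ[X]) (p : ι → ℂ[X]) : ℕ → ι → ℂ[X]
  | 0 => p
  | k + 1 => fun j =>
    D * derivative (jetNumerator D L p k j) - k * derivative D * jetNumerator D L p k j +
      ∑ i, jetNumerator D L p k i * L i j

theorem sum_jetNumerator_succ_eval_mul (D : ℂ[X]) (L : Matrix ι ι ℂ[X]) (p : ι → ℂ[X]) (k : ℕ)
    (v : ι → ℂ) (x : ℂ) :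
    ∑ i, (jetNumerator D L p (k + 1) i).eval x * v i =
      D.eval x * ∑ i, (derivative (jetNumerator D L p k i)).eval x * v i -
        k * (derivative D).eval x * ∑ i, (jetNumerator D L p k i).eval x * v i +
        ∑ i, (jetNumerator D L p k i).eval x * ∑ j, (L i j).eval x * v j := by
  have hswap : ∑ i, (jetNumerator D L p k i).eval x * ∑ j, (L i j).eval x * v j =
      ∑ j, (∑ i, (jetNumerator D L p k i).eval x * (L i j).eval x) * v j := by
    simp only [Finset.mul_sum, Finset.sum_mul, mul_assoc]
    exact Finset.sum_comm
  rw [hswap, Finset.mul_sum, Finset.mul_sum, ← Finset.sum_sub_distrib, ← Finset.sum_add_distrib]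
  refine Finset.sum_congr rfl fun j _ => ?_
  simp only [jetNumerator, eval_add, eval_sub, eval_mul, eval_natCast, eval_finsetSum]
  ring

theorem iteratedDeriv_eqOn_jetNumerator {U : Set ℂ} (hU : IsOpen U) {D : ℂ[X]}
    {L : Matrix ι ι ℂ[X]} {v : ι → ℂ → ℂ} (hD : ∀ x ∈ U, D.eval x ≠ 0)
    (hv : ∀ x ∈ U, ∀ i, HasDerivAt (v i) ((∑ j, (L i j).eval x * v j x) / D.eval x) x)
    (p : ι → ℂ[X]) (k : ℕ) :
    U.EqOn (iteratedDeriv k fun x => ∑ i, (p i).eval x * v i x)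
      fun x => (∑ i, (jetNumerator D L p k i).eval x * v i x) / D.eval x ^ k := by
  induction k with
  | zero => intro x _; simp [jetNumerator]
  | succ k ih =>
    intro x hx
    have hDx := hD x hx
    have hderiv := (HasDerivAt.fun_sum fun i (_ : i ∈ Finset.univ) =>
      ((jetNumerator D L p k i).hasDerivAt x).fun_mul (hv x hx i)).fun_div
        ((D.hasDerivAt x).fun_pow k) (pow_ne_zero k hDx)
    rw [iteratedDeriv_succ, (ih.eventuallyEq_of_mem (hU.mem_nhds hx)).deriv_eq, hderiv.deriv]
    simp only [sum_jetNumerator_succ_eval_mul, Finset.sum_add_distrib, mul_div_assoc',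
      ← Finset.sum_div]
    rcases k with _ | k <;> field_simp <;> push_cast <;> ring

theorem isSolutionAt_sum_mul {n : ℕ} {U : Set ℂ} (hU : IsOpen U) {D : ℂ[X]} {L : Matrix ι ι ℂ[X]}
    {v : ι → ℂ → ℂ} (hD : ∀ x ∈ U, D.eval x ≠ 0)
    (hv : ∀ x ∈ U, ∀ i, HasDerivAt (v i) ((∑ j, (L i j).eval x * v j x) / D.eval x) x)
    {p : ι → ℂ[X]} {a : Fin (n + 1) → ℂ[X]}
    (ha : ∀ i, ∑ k : Fin (n + 1), a k * jetNumerator D L p k i * D ^ (n - k : ℕ) = 0)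
    {x : ℂ} (hx : x ∈ U) :
    IsSolutionAt (fun k => (a k).eval) (fun y => ∑ i, (p i).eval y * v i y) x := by
  have hDx := hD x hx
  have hpow (k : Fin (n + 1)) : D.eval x ^ n = D.eval x ^ (n - k : ℕ) * D.eval x ^ (k : ℕ) := by
    rw [← pow_add, Nat.sub_add_cancel k.is_le]
  have hterm (k : Fin (n + 1)) :
      (a k).eval x * iteratedDeriv k (fun y => ∑ i, (p i).eval y * v i y) x =
        (∑ i, (a k * jetNumerator D L p k i * D ^ (n - k : ℕ)).eval x * v i x) / D.eval x ^ n := by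
    rw [iteratedDeriv_eqOn_jetNumerator hU hD hv p k hx, ← mul_div_assoc, Finset.mul_sum,
      div_eq_div_iff (pow_ne_zero _ hDx) (pow_ne_zero _ hDx), Finset.sum_mul, Finset.sum_mul]
    refine Finset.sum_congr rfl fun i _ => ?_
    rw [hpow k, eval_mul, eval_mul, eval_pow]
    ring
  rw [IsSolutionAt]
  simp only [hterm]
  rw [← Finset.sum_div, Finset.sum_comm]
  simp only [← Finset.sum_mul, ← eval_finsetSum, ha, eval_zero, zero_mul, Finset.sum_const_zero,
    zero_div]

theorem jetNumerator_unit_succ (D L : ℂ[X]) (p : Unit → ℂ[X]) (k : ℕ) :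
    jetNumerator D (fun _ _ => L) p (k + 1) () =
      D * derivative (jetNumerator D (fun _ _ => L) p k ()) +
        (L - k * derivative D) * jetNumerator D (fun _ _ => L) p k () := by
  simp only [jetNumerator, Finset.univ_unique, Finset.sum_singleton, PUnit.default_eq_unit]
  ring

theorem iteratedDeriv_mul_eqOn_jetNumerator {U : Set ℂ} (hU : IsOpen U) {D L : ℂ[X]} {v : ℂ → ℂ}
    (hD : ∀ x ∈ U, D.eval x ≠ 0)
    (hv : ∀ x ∈ U, HasDerivAt v (L.eval x * v x / D.eval x) x) (p : ℂ[X]) (k : ℕ) :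
    U.EqOn (iteratedDeriv k fun x => p.eval x * v x)
      fun x => (jetNumerator D (fun _ _ : Unit => L) (fun _ => p) k ()).eval x * v x /
        D.eval x ^ k := by
  simpa using iteratedDeriv_eqOn_jetNumerator hU hD (L := fun _ _ : Unit => L)
    (v := fun _ => v) (by simpa using hv) (fun _ => p) k

end PolynomialJets

section PullBack

variable {φ ρ f u : ℂ → ℂ} {x : ℂ}

/-- The operator `ρ d/dx + a`. For `ρ = φ / φ'` it is `pullEuler φ a`. -/
def eulerOp (ρ : ℂ → ℂ) (a : ℂ) (f : ℂ → ℂ) : ℂ → ℂ := fun x => ρ x * deriv f x + a * f x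

theorem pullEuler_congr {f g : ℂ → ℂ} (hfg : f =ᶠ[𝓝 x] g) (φ : ℂ → ℂ) (a : ℂ) :
    pullEuler φ a f =ᶠ[𝓝 x] pullEuler φ a g := by
  filter_upwards [hfg, hfg.deriv] with y hy hy'
  simp only [pullEuler, pullDeriv, hy, hy']

theorem pullEuler_eventuallyEq_eulerOp (hρ : ∀ᶠ y in 𝓝 x, φ y / deriv φ y = ρ y) (a : ℂ)
    (f : ℂ → ℂ) : pullEuler φ a f =ᶠ[𝓝 x] eulerOp ρ a f := by
  filter_upwards [hρ] with y hy
  rw [pullEuler, pullDeriv, eulerOp, mul_div_left_comm, hy, mul_comm (deriv f y)]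

theorem analyticAt_eulerOp (hρ : AnalyticAt ℂ ρ x) (hf : AnalyticAt ℂ f x) (a : ℂ) :
    AnalyticAt ℂ (eulerOp ρ a f) x := by
  unfold eulerOp
  fun_prop

theorem deriv_eulerOp (hρ : AnalyticAt ℂ ρ x) (hf : AnalyticAt ℂ f x) (a : ℂ) :
    deriv (eulerOp ρ a f) x =
      ρ x * iteratedDeriv 2 f x + deriv ρ x * deriv f x + a * deriv f x := by
  have h := (hρ.differentiableAt.hasDerivAt.mul hf.deriv.differentiableAt.hasDerivAt).add
    (hf.differentiableAt.hasDerivAt.const_mul a)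
  rw [iteratedDeriv_succ', iteratedDeriv_one, add_comm (ρ x * _)]
  exact h.deriv

theorem iteratedDeriv_two_eulerOp (hρ : AnalyticAt ℂ ρ x) (hf : AnalyticAt ℂ f x) (a : ℂ) :
    iteratedDeriv 2 (eulerOp ρ a f) x =
      ρ x * iteratedDeriv 3 f x + 2 * deriv ρ x * iteratedDeriv 2 f x +
        iteratedDeriv 2 ρ x * deriv f x + a * iteratedDeriv 2 f x := by
  unfold eulerOp
  rw [iteratedDeriv_fun_add (hρ.fun_mul hf.deriv).contDiffAt
      (analyticAt_const.fun_mul hf).contDiffAt,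
    iteratedDeriv_fun_mul hρ.contDiffAt hf.deriv.contDiffAt, iteratedDeriv_const_mul_field]
  simp only [Finset.sum_range_succ, Finset.sum_range_zero, ← iteratedDeriv_succ']
  norm_num

theorem hypEqAt_iff_eulerOp {a₁ a₂ a₃ b₁ b₂ : ℂ} (hφ : φ x ≠ 0)
    (hρ : ∀ᶠ y in 𝓝 x, φ y / deriv φ y = ρ y) :
    HypEqAt a₁ a₂ a₃ b₁ b₂ φ u x ↔
      φ x * eulerOp ρ a₁ (eulerOp ρ a₂ (eulerOp ρ a₃ u)) x =
        eulerOp ρ 0 (eulerOp ρ (b₁ - 1) (eulerOp ρ (b₂ - 1) u)) x := by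
  have hcomp (a b : ℂ) :
      pullEuler φ a (pullEuler φ b u) =ᶠ[𝓝 x] eulerOp ρ a (eulerOp ρ b u) :=
    (pullEuler_congr (pullEuler_eventuallyEq_eulerOp hρ b u) φ a).trans
      (pullEuler_eventuallyEq_eulerOp hρ a _)
  have hleft := ((pullEuler_congr (hcomp a₂ a₃) φ a₁).trans
    (pullEuler_eventuallyEq_eulerOp hρ a₁ _)).self_of_nhds
  have hright : φ x * pullDeriv φ (pullEuler φ (b₁ - 1) (pullEuler φ (b₂ - 1) u)) x =
      eulerOp ρ 0 (eulerOp ρ (b₁ - 1) (eulerOp ρ (b₂ - 1) u)) x := by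
    simpa only [pullEuler, zero_mul, add_zero] using ((pullEuler_congr (hcomp _ _) φ 0).trans
      (pullEuler_eventuallyEq_eulerOp hρ 0 _)).self_of_nhds
  rw [HypEqAt, ← mul_right_inj' hφ, hleft, hright]

/-- With `θ = ρ d/dx` this is
`φ (θ + a₁) (θ + a₂) (θ + a₃) u - θ (θ + b₁ - 1) (θ + b₂ - 1) u = 0`, expanded. -/
theorem hypEqAt_iff_iteratedDeriv {a₁ a₂ a₃ b₁ b₂ : ℂ} (hφ : φ x ≠ 0)
    (hρ : ∀ᶠ y in 𝓝 x, φ y / deriv φ y = ρ y) (hρa : AnalyticAt ℂ ρ x) (hu : AnalyticAt ℂ u x) :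
    HypEqAt a₁ a₂ a₃ b₁ b₂ φ u x ↔
      (φ x - 1) * ρ x ^ 3 * iteratedDeriv 3 u x +
        (3 * (φ x - 1) * deriv ρ x + ((a₁ + a₂ + a₃) * φ x - (b₁ + b₂ - 2))) * ρ x ^ 2 *
          iteratedDeriv 2 u x +
        ((φ x - 1) * (deriv ρ x ^ 2 + ρ x * iteratedDeriv 2 ρ x) +
          ((a₁ + a₂ + a₃) * φ x - (b₁ + b₂ - 2)) * deriv ρ x +
          ((a₁ * a₂ + a₁ * a₃ + a₂ * a₃) * φ x - (b₁ - 1) * (b₂ - 1))) * ρ x * deriv u x +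
        a₁ * a₂ * a₃ * φ x * u x = 0 := by
  have hexpand (a b c : ℂ) : eulerOp ρ a (eulerOp ρ b (eulerOp ρ c u)) x =
      ρ x ^ 3 * iteratedDeriv 3 u x +
        (3 * deriv ρ x + (a + b + c)) * ρ x ^ 2 * iteratedDeriv 2 u x +
        (deriv ρ x ^ 2 + ρ x * iteratedDeriv 2 ρ x + (a + b + c) * deriv ρ x +
          (a * b + a * c + b * c)) * ρ x * deriv u x + a * b * c * u x := by
    have hc := analyticAt_eulerOp hρa hu c
    rw [eulerOp, deriv_eulerOp hρa hc, iteratedDeriv_two_eulerOp hρa hu, deriv_eulerOp hρa hu,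
      eulerOp, deriv_eulerOp hρa hu, eulerOp]
    ring
  rw [hypEqAt_iff_eulerOp hφ hρ, hexpand, hexpand, ← sub_eq_zero]
  refine Eq.congr_left ?_
  ring

end PullBack

section PowerSeries

/-- On the open unit disc `f` is the sum of the power series with coefficients `c`. -/
def IsPowerSeriesOnDisc (c : ℕ → ℂ) (f : ℂ → ℂ) : Prop :=
  ∀ z : ℂ, ‖z‖ < 1 → HasSum (fun n => c n * z ^ n) (f z)

variable {c : ℕ → ℂ} {f : ℂ → ℂ} {z : ℂ}

theorem IsPowerSeriesOnDisc.exists_summable_bound (hf : IsPowerSeriesOnDisc c f) (hz : ‖z‖ < 1) :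
    ∃ r : ℝ, z ∈ Metric.ball (0 : ℂ) r ∧ Metric.ball (0 : ℂ) r ⊆ Metric.ball 0 1 ∧
      Summable (fun n => ‖c n‖ * r ^ n) ∧
      ∀ n, ∀ w ∈ Metric.ball (0 : ℂ) r, ‖c n * w ^ n‖ ≤ ‖c n‖ * r ^ n := by
  obtain ⟨r, hzr, hr⟩ := exists_between hz
  have hr₀ : 0 ≤ r := (norm_nonneg z).trans hzr.le
  refine ⟨r, by simpa using hzr, Metric.ball_subset_ball hr.le, ?_, fun n w hw => ?_⟩
  · simpa [abs_of_nonneg hr₀] using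
      (hf r (by simpa [abs_of_nonneg hr₀] using hr)).summable.norm
  · have hwr : ‖w‖ ≤ r := (mem_ball_zero_iff.1 hw).le
    rw [norm_mul, norm_pow]
    gcongr

theorem IsPowerSeriesOnDisc.eqOn_tsum (hf : IsPowerSeriesOnDisc c f) :
    (Metric.ball (0 : ℂ) 1).EqOn f fun w => ∑' n, c n * w ^ n := fun w hw =>
  (hf w (mem_ball_zero_iff.1 hw)).tsum_eq.symm

theorem IsPowerSeriesOnDisc.analyticAt (hf : IsPowerSeriesOnDisc c f) (hz : ‖z‖ < 1) :
    AnalyticAt ℂ f z := by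
  obtain ⟨r, hzr, hr, hsum, hbound⟩ := hf.exists_summable_bound hz
  have hdiff := differentiableOn_tsum_of_summable_norm hsum (fun n => by fun_prop)
    Metric.isOpen_ball hbound
  exact (hdiff.congr (hf.eqOn_tsum.mono hr)).analyticAt (Metric.isOpen_ball.mem_nhds hzr)

theorem IsPowerSeriesOnDisc.mul_deriv (hf : IsPowerSeriesOnDisc c f) :
    IsPowerSeriesOnDisc (fun n => n * c n) fun z => z * deriv f z := by
  intro z hz
  obtain ⟨r, hzr, hr, hsum, hbound⟩ := hf.exists_summable_bound hz
  have hderiv := hasSum_deriv_of_summable_norm hsum (fun n => by fun_prop)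
    Metric.isOpen_ball hbound hzr
  rw [← ((hf.eqOn_tsum.mono hr).eventuallyEq_of_mem
    (Metric.isOpen_ball.mem_nhds hzr)).deriv_eq] at hderiv
  refine (hderiv.mul_left z).congr_fun fun n => ?_
  rw [deriv_const_mul_field, deriv_pow_field]
  rcases n with _ | n
  · simp
  · rw [Nat.add_sub_cancel]
    ring

theorem IsPowerSeriesOnDisc.pullEuler (hf : IsPowerSeriesOnDisc c f) (a : ℂ) :
    IsPowerSeriesOnDisc (fun n => (n + a) * c n) (pullEuler id a f) := by
  intro z hz
  simpa [Darboux3B.pullEuler, pullDeriv, add_mul, mul_assoc] using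
    (hf.mul_deriv z hz).add ((hf z hz).mul_left a)

end PowerSeries

section Hypergeometric

variable (a₁ a₂ a₃ b₁ b₂ : ℂ)

theorem hyp32Coeff_zero : hyp32Coeff a₁ a₂ a₃ b₁ b₂ 0 = 1 := by
  simp [hyp32Coeff]

theorem hyp32Coeff_succ (n : ℕ) : hyp32Coeff a₁ a₂ a₃ b₁ b₂ (n + 1) =
    (a₁ + n) * (a₂ + n) * (a₃ + n) / ((b₁ + n) * (b₂ + n) * (n + 1)) *
      hyp32Coeff a₁ a₂ a₃ b₁ b₂ n := by
  simp only [hyp32Coeff, ascPochhammer_succ_eval, Nat.factorial_succ, ← mul_div_mul_comm]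
  push_cast
  congr 1 <;> ring

theorem summable_hyp32 {z : ℂ} (hz : ‖z‖ < 1) :
    Summable fun n => hyp32Coeff a₁ a₂ a₃ b₁ b₂ n * z ^ n := by
  have hquot (a b : ℂ) : Tendsto (fun n : ℕ => (a + n) / (b + n)) atTop (𝓝 1) := by
    simpa using tendsto_add_mul_div_add_mul_atTop_nhds a b (1 : ℂ) one_ne_zero
  have hratio : Tendsto
      (fun n : ℕ => ‖(a₁ + n) / (b₁ + n) * ((a₂ + n) / (b₂ + n)) * ((a₃ + n) / (1 + n)) * z‖)
      atTop (𝓝 ‖z‖) := by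
    simpa using ((((hquot a₁ b₁).mul (hquot a₂ b₂)).mul (hquot a₃ 1)).mul_const z).norm
  obtain ⟨r, hzr, hr⟩ := exists_between hz
  refine summable_of_ratio_norm_eventually_le hr ((hratio.eventually_lt_const hzr).mono
    fun n hn => ?_)
  calc ‖hyp32Coeff a₁ a₂ a₃ b₁ b₂ (n + 1) * z ^ (n + 1)‖
      = ‖(a₁ + n) / (b₁ + n) * ((a₂ + n) / (b₂ + n)) * ((a₃ + n) / (1 + n)) * z‖ *
          ‖hyp32Coeff a₁ a₂ a₃ b₁ b₂ n * z ^ n‖ := by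
        rw [hyp32Coeff_succ, ← norm_mul]
        congr 1
        simp only [← mul_div_mul_comm, add_comm (n : ℂ) 1, pow_succ]
        ring
    _ ≤ r * ‖hyp32Coeff a₁ a₂ a₃ b₁ b₂ n * z ^ n‖ := by gcongr

theorem isPowerSeriesOnDisc_hyp32 :
    IsPowerSeriesOnDisc (hyp32Coeff a₁ a₂ a₃ b₁ b₂) (hyp32 a₁ a₂ a₃ b₁ b₂) := fun _ hz =>
  (summable_hyp32 a₁ a₂ a₃ b₁ b₂ hz).hasSum

theorem hyp32_zero : hyp32 a₁ a₂ a₃ b₁ b₂ 0 = 1 := by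
  rw [hyp32, tsum_eq_single 0 fun n hn => by simp [hn]]
  simp [hyp32Coeff_zero]

variable {b₁ b₂}

theorem add_natCast_ne_zero {b : ℂ} (hb : 0 < b.re) (n : ℕ) : b + n ≠ 0 := fun h => by
  have hre := congrArg re h
  rw [add_re, natCast_re, zero_re] at hre
  linarith [n.cast_nonneg (α := ℝ)]

theorem hyp32Coeff_succ_mul (hb₁ : ∀ n : ℕ, b₁ + n ≠ 0) (hb₂ : ∀ n : ℕ, b₂ + n ≠ 0) (n : ℕ) :
    (n + 1) * (b₁ + n) * (b₂ + n) * hyp32Coeff a₁ a₂ a₃ b₁ b₂ (n + 1) =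
      (a₁ + n) * (a₂ + n) * (a₃ + n) * hyp32Coeff a₁ a₂ a₃ b₁ b₂ n := by
  have h₁ := hb₁ n
  have h₂ := hb₂ n
  have h₃ : (n : ℂ) + 1 ≠ 0 := n.cast_add_one_ne_zero
  rw [hyp32Coeff_succ]
  field_simp

theorem mul_pullEuler_hyp32 (hb₁ : ∀ n : ℕ, b₁ + n ≠ 0) (hb₂ : ∀ n : ℕ, b₂ + n ≠ 0)
    {c₁ c₂ c₃ : ℂ} (hc : ∀ t, (t + c₁) * (t + c₂) * (t + c₃) = t * (t + b₁ - 1) * (t + b₂ - 1))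
    {z : ℂ} (hz : ‖z‖ < 1) :
    z * pullEuler id a₁ (pullEuler id a₂ (pullEuler id a₃ (hyp32 a₁ a₂ a₃ b₁ b₂))) z =
      pullEuler id c₁ (pullEuler id c₂ (pullEuler id c₃ (hyp32 a₁ a₂ a₃ b₁ b₂))) z := by
  have hF := isPowerSeriesOnDisc_hyp32 a₁ a₂ a₃ b₁ b₂
  have hleft := ((((hF.pullEuler a₃).pullEuler a₂).pullEuler a₁) z hz).mul_left z
  have hright := (((hF.pullEuler c₃).pullEuler c₂).pullEuler c₁) z hz
  rw [← hasSum_nat_add_iff' 1] at hright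
  have hconst : c₁ * c₂ * c₃ = 0 := by simpa using hc 0
  simp only [Finset.sum_range_one, Nat.cast_zero, zero_add, ← mul_assoc, hconst, zero_mul,
    sub_zero] at hright
  refine hleft.unique (hright.congr_fun fun n => ?_)
  have hsucc := hyp32Coeff_succ_mul a₁ a₂ a₃ hb₁ hb₂ n
  have hn := hc (n + 1)
  push_cast
  linear_combination -z ^ (n + 1) * (hyp32Coeff a₁ a₂ a₃ b₁ b₂ (n + 1) * hn + hsucc)

variable {a₁ a₂ a₃}

theorem pullEuler_mul_comp {φ g F : ℂ → ℂ} {e x : ℂ} (hφ : DifferentiableAt ℂ φ x)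
    (hφ' : deriv φ x ≠ 0) (hg : DifferentiableAt ℂ g x) (hge : pullEuler φ (-e) g x = 0)
    (hF : DifferentiableAt ℂ F (φ x)) (a : ℂ) :
    pullEuler φ a (fun y => g y * F (φ y)) x = g x * pullEuler id (a + e) F (φ x) := by
  have hderiv : deriv (fun y => g y * F (φ y)) x =
      deriv g x * F (φ x) + g x * (deriv F (φ x) * deriv φ x) :=
    (hg.hasDerivAt.mul (hF.hasDerivAt.comp x hφ.hasDerivAt)).deriv
  simp only [pullEuler, pullDeriv, hderiv, deriv_id, id] at hge ⊢
  field_simp at hge ⊢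
  linear_combination F (φ x) * hge

theorem hypEqAt_mul_hyp32_comp {φ g : ℂ → ℂ} {β₁ β₂ e x : ℂ} (hφa : AnalyticAt ℂ φ x)
    (hφ : φ x ≠ 0) (hφ' : deriv φ x ≠ 0) (hφ₁ : ‖φ x‖ < 1) (hg : AnalyticAt ℂ g x)
    (hge : pullEuler φ (-e) g =ᶠ[𝓝 x] 0)
    (hb₁ : ∀ n : ℕ, b₁ + n ≠ 0) (hb₂ : ∀ n : ℕ, b₂ + n ≠ 0)
    (hindicial : ∀ t, (t + e) * (t + (β₁ - 1 + e)) * (t + (β₂ - 1 + e)) =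
      t * (t + b₁ - 1) * (t + b₂ - 1)) :
    HypEqAt a₁ a₂ a₃ β₁ β₂ φ
      (fun y => g y * hyp32 (a₁ + e) (a₂ + e) (a₃ + e) b₁ b₂ (φ y)) x := by
  have hshift {c : ℕ → ℂ} {F : ℂ → ℂ} (hF : IsPowerSeriesOnDisc c F) (a : ℂ) :
      pullEuler φ a (fun y => g y * F (φ y)) =ᶠ[𝓝 x]
        fun y => g y * pullEuler id (a + e) F (φ y) := by
    filter_upwards [hφa.eventually_analyticAt, hg.eventually_analyticAt, hge,
      hφa.deriv.continuousAt.eventually_ne hφ', hφa.continuousAt.norm.eventually_lt_const hφ₁]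
      with y hφy hgy hgey hφ'y hφy₁
    exact pullEuler_mul_comp hφy.differentiableAt hφ'y hgy.differentiableAt hgey
      (hF.analyticAt hφy₁).differentiableAt a
  have hF := isPowerSeriesOnDisc_hyp32 (a₁ + e) (a₂ + e) (a₃ + e) b₁ b₂
  have hshift₂ (a b : ℂ) := (pullEuler_congr (hshift hF b) φ a).trans (hshift (hF.pullEuler _) a)
  have hshift₃ (a b c : ℂ) : pullEuler φ a (pullEuler φ b (pullEuler φ c fun y =>
      g y * hyp32 (a₁ + e) (a₂ + e) (a₃ + e) b₁ b₂ (φ y))) x =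
      g x * pullEuler id (a + e) (pullEuler id (b + e) (pullEuler id (c + e)
        (hyp32 (a₁ + e) (a₂ + e) (a₃ + e) b₁ b₂))) (φ x) :=
    ((pullEuler_congr (hshift₂ b c) φ a).trans
      (hshift ((hF.pullEuler _).pullEuler _) a)).self_of_nhds
  have hright := hshift₃ 0 (β₁ - 1) (β₂ - 1)
  rw [pullEuler, zero_mul, add_zero, zero_add,
    ← mul_pullEuler_hyp32 (a₁ + e) (a₂ + e) (a₃ + e) hb₁ hb₂ hindicial hφ₁] at hright
  rw [HypEqAt, ← mul_right_inj' hφ, hright, hshift₃, mul_left_comm]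

end Hypergeometric

section Polynomials

open Polynomial

/-- `7 P₃`. -/
def polyP : ℂ[X] := X ^ 3 - 7 * X + 7

/-- `-1372 Q₃`; the zeros of `x A` are the points of the fibre of `Ψ₃` over `0`. -/
def polyA : ℂ[X] := (3 * X ^ 2 - 7) * (2 * X ^ 2 - 7 * X + 7) * (11 * X ^ 2 - 35 * X + 28)

/-- `3 Y₀²`. -/
def polyT : ℂ[X] := 3 - 2 * X

/-- `4 S²`. -/
def polyB : ℂ[X] := 4 * X ^ 4 - 21 * X ^ 2 + 28

/-- The zeros of `R` are the double points of the fibre of `Ψ₃` over `1`. -/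
def polyR : ℂ[X] :=
  27 * X ^ 8 - 252 * X ^ 7 + 945 * X ^ 6 - 1750 * X ^ 5 + 1365 * X ^ 4 + 588 * X ^ 3 -
    2205 * X ^ 2 + 1862 * X - 588

/-- The coefficient of `y'` in the equation for `y ∘ Ψ₃` is `2 P N₁`. -/
def polyN₁ : ℂ[X] :=
  -192 * X ^ 9 + 144 * X ^ 8 + 3486 * X ^ 7 - 7203 * X ^ 6 - 9996 * X ^ 5 + 41202 * X ^ 4 -
    30282 * X ^ 3 - 19551 * X ^ 2 + 34692 * X - 12348

/-- The coefficient of `y''` in the equation for `y ∘ Ψ₃` is `4 P² N₂`. -/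
def polyN₂ : ℂ[X] :=
  -96 * X ^ 7 + 108 * X ^ 6 + 1036 * X ^ 5 - 1953 * X ^ 4 - 1344 * X ^ 3 + 4599 * X ^ 2 -
    1862 * X - 588

/-- The coefficients of the equation for `y ∘ Ψ₃`, where `y` satisfies the hypergeometric
equation. -/
def pulledBackODE : Fin 4 → ℂ[X] :=
  ![105 * polyR, 2 * polyP * polyN₁, 4 * polyP ^ 2 * polyN₂, 8 * polyP ^ 3 * polyT * polyB]

/-- The coefficients of the equation for `√P₃ (y ∘ Ψ₃)`, where `y` satisfies the hypergeometric
equation. -/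
def normalizedODE : Fin 4 → ℂ[X] :=
  ![-3 * X ^ 8 - 9 * X ^ 7 + 252 * X ^ 6 - 966 * X ^ 5 + 1365 * X ^ 4 - 819 * X ^ 3 +
      1323 * X ^ 2 - 2793 * X + 1764,
    6 * X ^ 9 + 9 * X ^ 8 - 294 * X ^ 7 + 924 * X ^ 6 - 448 * X ^ 5 - 1827 * X ^ 4 +
      882 * X ^ 3 + 6027 * X ^ 2 - 9310 * X + 4116,
    polyP * (-12 * X ^ 7 + 245 * X ^ 5 - 567 * X ^ 4 + 21 * X ^ 3 + 1260 * X ^ 2 - 1519 * X + 588),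
    polyP ^ 2 * polyT * polyB]

/-- The `k`-th derivative of `49 Ψ₃ / Ψ₃' = x A P / R` is `ratioNumerator k / R ^ (k + 1)`. -/
def ratioNumerator (k : ℕ) : ℂ[X] :=
  jetNumerator polyR (fun _ _ : Unit => -derivative polyR) (fun _ => X * polyA * polyP) k ()

/-- The `k`-th derivative of `1 / √P₃` is `sqrtNumerator k / (2 P) ^ k / √P₃`. -/
def sqrtNumerator (k : ℕ) : ℂ[X] :=
  jetNumerator (2 * polyP) (fun _ _ : Unit => -derivative polyP) (fun _ => 1) k ()

theorem derivative_polyP : derivative polyP = 3 * X ^ 2 - 7 := by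
  norm_num [polyP, map_ofNat C]

theorem derivative_polyA : derivative polyA =
    396 * X ^ 5 - 2205 * X ^ 4 + 3920 * X ^ 3 - 882 * X ^ 2 - 4116 * X + 3087 := by
  simp [polyA]
  ring

theorem derivative_polyR : derivative polyR =
    216 * X ^ 7 - 1764 * X ^ 6 + 5670 * X ^ 5 - 8750 * X ^ 4 + 5460 * X ^ 3 + 1764 * X ^ 2 -
      4410 * X + 1862 := by
  simp [polyR, map_ofNat C]
  ring

/-- `Ψ₃ = x³ A³ / (1728 P⁷)` is a Belyi function: it ramifies only over `0`, `1` and `∞`. -/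
theorem sub_eq_mul_polyR_sq :
    1728 * polyP ^ 7 - X ^ 3 * polyA ^ 3 = 49 * polyR ^ 2 * polyT * polyB := by
  rw [polyP, polyA, polyR, polyT, polyB]
  ring

theorem logDeriv_numerator_eq :
    3 * polyA * polyP + 3 * X * derivative polyA * polyP - 7 * X * polyA * derivative polyP =
      49 * polyR := by
  rw [derivative_polyP, derivative_polyA, polyP, polyA, polyR]
  ring

theorem ratioNumerator_zero : ratioNumerator 0 = X * polyA * polyP := rfl

theorem ratioNumerator_one : ratioNumerator 1 =
    polyR * (polyA * polyP + X * (derivative polyA * polyP + polyA * derivative polyP)) -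
      X * polyA * polyP * derivative polyR := by
  rw [ratioNumerator, jetNumerator_unit_succ, ← ratioNumerator, ratioNumerator_zero,
    derivative_mul, derivative_mul, derivative_X]
  push_cast
  ring

theorem ratioNumerator_two : ratioNumerator 2 =
    polyR * derivative (ratioNumerator 1) - 2 * ratioNumerator 1 * derivative polyR := by
  rw [ratioNumerator, jetNumerator_unit_succ, ← ratioNumerator]
  push_cast
  ring

theorem sqrtNumerator_zero : sqrtNumerator 0 = 1 := rfl

theorem sqrtNumerator_succ (k : ℕ) : sqrtNumerator (k + 1) =
    2 * polyP * derivative (sqrtNumerator k) -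
      (2 * k + 1) * derivative polyP * sqrtNumerator k := by
  rw [sqrtNumerator, jetNumerator_unit_succ, ← sqrtNumerator, derivative_mul, derivative_ofNat]
  ring

theorem sqrtNumerator_one : sqrtNumerator 1 = -derivative polyP := by
  rw [sqrtNumerator_succ]
  simp [sqrtNumerator_zero]

theorem sqrtNumerator_two : sqrtNumerator 2 = 15 * X ^ 4 - 42 * X ^ 2 - 84 * X + 147 := by
  rw [sqrtNumerator_succ, sqrtNumerator_one, derivative_polyP, polyP]
  simp
  ring

theorem sqrtNumerator_three : sqrtNumerator 3 =
    2 * polyP * (60 * X ^ 3 - 84 * X - 84) - 5 * derivative polyP * sqrtNumerator 2 := by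
  rw [sqrtNumerator_succ, sqrtNumerator_two]
  simp [map_ofNat C]
  ring

theorem pulledBackODE_two_identity : 6 * polyT * polyB * ratioNumerator 1 =
    X ^ 3 * polyA ^ 3 + 2 * (1728 * polyP ^ 7) + X * polyA * polyR * polyN₂ := by
  rw [ratioNumerator_one, derivative_polyP, derivative_polyA, derivative_polyR, polyP, polyA,
    polyR, polyT, polyB, polyN₂]
  ring

theorem pulledBackODE_one_identity :
    252 * polyT * polyB * (ratioNumerator 1 ^ 2 + ratioNumerator 0 * ratioNumerator 2) =
      126 * (X ^ 3 * polyA ^ 3 + 2 * (1728 * polyP ^ 7)) * ratioNumerator 1 +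
        49 * polyR ^ 2 * (9 * X ^ 3 * polyA ^ 3 - 56 * (1728 * polyP ^ 7)) +
        63 * X ^ 2 * polyA ^ 2 * polyR ^ 2 * polyN₁ := by
  simp only [ratioNumerator_zero, ratioNumerator_two, ratioNumerator_one, derivative_mul,
    derivative_add, derivative_sub, derivative_X, derivative_polyP, derivative_polyA,
    derivative_polyR, derivative_X_pow, derivative_ofNat, Nat.cast_ofNat, map_ofNat C]
  rw [polyP, polyA, polyR, polyT, polyB, polyN₁]
  ring

theorem normalizedODE_two_identity :
    polyP * (polyN₂ - 3 * derivative polyP * polyT * polyB) = 2 * normalizedODE 2 := by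
  rw [derivative_polyP]
  simp only [polyP, polyT, polyB, polyN₂, normalizedODE, Matrix.cons_val]
  ring

theorem normalizedODE_one_identity :
    3 * polyT * polyB * sqrtNumerator 2 + 2 * polyN₂ * sqrtNumerator 1 + polyN₁ =
      4 * normalizedODE 1 := by
  rw [sqrtNumerator_two, sqrtNumerator_one, derivative_polyP]
  simp only [polyT, polyB, polyN₂, polyN₁, normalizedODE, Matrix.cons_val]
  ring

theorem normalizedODE_zero_identity :
    polyT * polyB * sqrtNumerator 3 + polyN₂ * sqrtNumerator 2 + polyN₁ * sqrtNumerator 1 +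
      105 * polyR = 8 * polyP * normalizedODE 0 := by
  rw [sqrtNumerator_three, sqrtNumerator_two, sqrtNumerator_one, derivative_polyP]
  simp only [polyP, polyT, polyB, polyN₂, polyN₁, polyR, normalizedODE, Matrix.cons_val]
  ring

end Polynomials

section PullBackPsi3

open Polynomial

theorem P3_eq (x : ℂ) : P3 x = polyP.eval x / 7 := by
  simp only [P3, polyP, eval_add, eval_sub, eval_mul, eval_pow, eval_X, eval_ofNat]
  ring

theorem Q3_eq (x : ℂ) : Q3 x = -polyA.eval x / 1372 := by
  simp only [Q3, polyA, eval_add, eval_sub, eval_mul, eval_pow, eval_X, eval_ofNat]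
  ring

theorem Psi3_eq (x : ℂ) :
    Psi3 x = x ^ 3 * polyA.eval x ^ 3 / (1728 * polyP.eval x ^ 7) := by
  simp only [Psi3, polyA, polyP, eval_add, eval_sub, eval_mul, eval_pow, eval_X, eval_ofNat]
  ring

theorem hasDerivAt_cpow_const_of_mem_slitPlane {f : ℂ → ℂ} {f' x : ℂ} (c : ℂ)
    (hf : HasDerivAt f f' x) (hx : f x ∈ slitPlane) :
    HasDerivAt (fun y => f y ^ c) (c * f' * f x ^ c / f x) x := by
  refine (hf.cpow_const hx).congr_deriv ?_
  rw [cpow_sub _ _ (slitPlane_ne_zero hx), cpow_one]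
  ring

theorem analyticAt_P3_cpow {x : ℂ} (hx : P3 x ∈ slitPlane) (c : ℂ) :
    AnalyticAt ℂ (fun y => P3 y ^ c) x := by
  have h : AnalyticAt ℂ P3 x := by unfold P3; fun_prop
  exact h.cpow analyticAt_const hx

theorem eventually_P3_mem_slitPlane {x : ℂ} (hx : P3 x ∈ slitPlane) :
    ∀ᶠ y in 𝓝 x, P3 y ∈ slitPlane := by
  have h : ContinuousAt P3 x := by unfold P3; fun_prop
  exact h.eventually_mem (isOpen_slitPlane.mem_nhds hx)

theorem polyP_eval_ne_zero {x : ℂ} (hx : P3 x ≠ 0) : polyP.eval x ≠ 0 := fun h =>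
  hx (by rw [P3_eq, h, zero_div])

theorem hasDerivAt_P3_cpow {x : ℂ} (hx : P3 x ∈ slitPlane) (c : ℂ) :
    HasDerivAt (fun y => P3 y ^ c)
      ((C c * derivative polyP).eval x * P3 x ^ c / polyP.eval x) x := by
  have hP3 : HasDerivAt P3 ((derivative polyP).eval x / 7) x :=
    ((polyP.hasDerivAt x).div_const 7).congr_of_eventuallyEq (.of_forall P3_eq)
  refine (hasDerivAt_cpow_const_of_mem_slitPlane c hP3 hx).congr_deriv ?_
  have hP := polyP_eval_ne_zero (slitPlane_ne_zero hx)
  generalize P3 x ^ c = v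
  rw [P3_eq, eval_mul, eval_C]
  field_simp

theorem eval_logDeriv_numerator (x : ℂ) :
    3 * polyA.eval x * polyP.eval x + 3 * x * (derivative polyA).eval x * polyP.eval x -
      7 * x * polyA.eval x * (derivative polyP).eval x = 49 * polyR.eval x := by
  simpa using congrArg (eval x) logDeriv_numerator_eq

theorem hasDerivAt_Psi3 {x : ℂ} (hP : polyP.eval x ≠ 0) :
    HasDerivAt Psi3
      (49 * x ^ 2 * polyA.eval x ^ 2 * polyR.eval x / (1728 * polyP.eval x ^ 8)) x := by
  have h : HasDerivAt Psi3 _ x :=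
    ((((hasDerivAt_id x).fun_pow 3).fun_mul ((polyA.hasDerivAt x).fun_pow 3)).fun_div
      (((polyP.hasDerivAt x).fun_pow 7).const_mul 1728)
      (mul_ne_zero (by norm_num) (pow_ne_zero 7 hP))).congr_of_eventuallyEq (.of_forall Psi3_eq)
  refine h.congr_deriv ?_
  simp only [id]
  field_simp
  push_cast
  linear_combination x ^ 2 * polyA.eval x ^ 2 * polyP.eval x ^ 6 * eval_logDeriv_numerator x

theorem analyticAt_Psi3 {x : ℂ} (hP : polyP.eval x ≠ 0) : AnalyticAt ℂ Psi3 x := by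
  have hP' := polyP.differentiable.analyticAt x
  have hA := polyA.differentiable.analyticAt x
  have h : AnalyticAt ℂ
      (fun y => y ^ 3 * polyA.eval y ^ 3 / (1728 * polyP.eval y ^ 7)) x := by
    fun_prop (disch := simpa using hP)
  exact h.congr (.of_forall fun y => (Psi3_eq y).symm)

theorem Psi3_div_deriv {x : ℂ} (hx : x ≠ 0) (hP : polyP.eval x ≠ 0) (hA : polyA.eval x ≠ 0)
    (hR : polyR.eval x ≠ 0) :
    Psi3 x / deriv Psi3 x = x * polyA.eval x * polyP.eval x / (49 * polyR.eval x) := by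
  rw [(hasDerivAt_Psi3 hP).deriv, Psi3_eq]
  field_simp

theorem iteratedDeriv_ratio {x : ℂ} (hR : polyR.eval x ≠ 0) (k : ℕ) :
    iteratedDeriv k (fun y => y * polyA.eval y * polyP.eval y / (49 * polyR.eval y)) x =
      (ratioNumerator k).eval x / (49 * polyR.eval x ^ (k + 1)) := by
  have hU : IsOpen {y : ℂ | polyR.eval y ≠ 0} := isOpen_ne_fun polyR.continuous continuous_const
  have hv (y : ℂ) (hy : polyR.eval y ≠ 0) :
      HasDerivAt (fun t => (49 * polyR.eval t)⁻¹)
        ((-derivative polyR).eval y * (49 * polyR.eval y)⁻¹ / polyR.eval y) y := by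
    refine (((polyR.hasDerivAt y).const_mul 49).fun_inv (by simpa using hy)).congr_deriv ?_
    rw [eval_neg]
    field_simp
  have h := iteratedDeriv_mul_eqOn_jetNumerator hU (fun _ hy => hy) hv (X * polyA * polyP) k hR
  simp only [eval_mul, eval_X, ← div_eq_mul_inv] at h
  rw [h, ← ratioNumerator, div_div, pow_succ', mul_assoc]

theorem Psi3_sub_one {x : ℂ} (hP : polyP.eval x ≠ 0) : Psi3 x - 1 =
    -(49 * polyR.eval x ^ 2 * polyT.eval x * polyB.eval x) / (1728 * polyP.eval x ^ 7) := by
  have h := by simpa using congrArg (eval x) sub_eq_mul_polyR_sq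
  rw [Psi3_eq]
  field_simp
  linear_combination -h

theorem pulledBackODE_two_eval_identity {x : ℂ} (hP : polyP.eval x ≠ 0) (hR : polyR.eval x ≠ 0) :
    3 * (Psi3 x - 1) * ((ratioNumerator 1).eval x / (49 * polyR.eval x ^ 2)) +
        (1 / 2 * Psi3 x + 1) =
      -(x * polyA.eval x * polyR.eval x * polyN₂.eval x) / (2 * 1728 * polyP.eval x ^ 7) := by
  have h := by simpa using congrArg (eval x) pulledBackODE_two_identity
  rw [Psi3_sub_one hP, Psi3_eq]
  field_simp
  linear_combination -h

theorem pulledBackODE_one_eval_identity {x : ℂ} (hP : polyP.eval x ≠ 0) (hR : polyR.eval x ≠ 0) :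
    (Psi3 x - 1) * (((ratioNumerator 1).eval x / (49 * polyR.eval x ^ 2)) ^ 2 +
          x * polyA.eval x * polyP.eval x / (49 * polyR.eval x) *
            ((ratioNumerator 2).eval x / (49 * polyR.eval x ^ 3))) +
        (1 / 2 * Psi3 x + 1) * ((ratioNumerator 1).eval x / (49 * polyR.eval x ^ 2)) +
        (1 / 28 * Psi3 x - 2 / 9) =
      -(x ^ 2 * polyA.eval x ^ 2 * polyN₁.eval x) / (4 * 49 * 1728 * polyP.eval x ^ 7) := by
  have h := by
    simpa [ratioNumerator_zero] using congrArg (eval x) pulledBackODE_one_identity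
  rw [Psi3_sub_one hP, Psi3_eq]
  field_simp
  linear_combination -8 * h

/-- The coefficients of both equations agree up to the factor `-Psi3 x / (8 * 49 ^ 2 * R)`. -/
theorem hypEqAt_Psi3_iff {x : ℂ} {u : ℂ → ℂ} (hx : x ≠ 0) (hP : polyP.eval x ≠ 0)
    (hA : polyA.eval x ≠ 0) (hR : polyR.eval x ≠ 0) (hu : AnalyticAt ℂ u x) :
    HypEqAt (-1 / 14) (3 / 14) (5 / 14) (1 / 3) (2 / 3) Psi3 u x ↔
      IsSolutionAt (fun k => (pulledBackODE k).eval) u x := by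
  have hΨ : Psi3 x ≠ 0 := by simp [Psi3_eq, hx, hP, hA]
  have hρ : ∀ᶠ y in 𝓝 x,
      Psi3 y / deriv Psi3 y = y * polyA.eval y * polyP.eval y / (49 * polyR.eval y) := by
    filter_upwards [eventually_ne_nhds hx, polyP.continuousAt.eventually_ne hP,
      polyA.continuousAt.eventually_ne hA, polyR.continuousAt.eventually_ne hR] with y
    exact Psi3_div_deriv
  have hρa : AnalyticAt ℂ
      (fun y => y * polyA.eval y * polyP.eval y / (49 * polyR.eval y)) x :=
    ((analyticAt_id.mul (polyA.differentiable.analyticAt x)).mul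
      (polyP.differentiable.analyticAt x)).div
        (analyticAt_const.mul (polyR.differentiable.analyticAt x)) (mul_ne_zero (by norm_num) hR)
  have hρ₁ := iteratedDeriv_ratio hR 1
  rw [iteratedDeriv_one] at hρ₁
  have hm : -Psi3 x / (8 * 49 ^ 2 * polyR.eval x) ≠ 0 := by simp [hΨ, hR]
  rw [hypEqAt_iff_iteratedDeriv hΨ hρ hρa hu, hρ₁, iteratedDeriv_ratio hR 2,
    isSolutionAt_three_iff]
  refine (Eq.congr_left ?_).trans (mul_eq_zero_iff_left hm)
  simp only [pulledBackODE, Matrix.cons_val]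
  norm_num [iteratedDeriv_zero, iteratedDeriv_one]
  rw [pulledBackODE_one_eval_identity hP hR, pulledBackODE_two_eval_identity hP hR,
    Psi3_sub_one hP, Psi3_eq]
  field_simp
  ring

theorem P3_cpow_half_ne_zero {x : ℂ} (hx : P3 x ≠ 0) : P3 x ^ (1 / 2 : ℂ) ≠ 0 := by
  simp [cpow_eq_zero_iff, hx]

theorem iteratedDeriv_inv_sqrt_P3 {x : ℂ} (hx : P3 x ∈ slitPlane) (k : ℕ) :
    iteratedDeriv k (fun y => (P3 y ^ (1 / 2 : ℂ))⁻¹) x =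
      (sqrtNumerator k).eval x * (P3 x ^ (1 / 2 : ℂ))⁻¹ / (2 * polyP.eval x) ^ k := by
  have hU : IsOpen (P3 ⁻¹' slitPlane) := isOpen_slitPlane.preimage (by unfold P3; fun_prop)
  have hv (y : ℂ) (hy : P3 y ∈ slitPlane) : HasDerivAt (fun t => (P3 t ^ (1 / 2 : ℂ))⁻¹)
      ((-derivative polyP).eval y * (P3 y ^ (1 / 2 : ℂ))⁻¹ / (2 * polyP).eval y) y := by
    have hP := polyP_eval_ne_zero (slitPlane_ne_zero hy)
    have h₀ := P3_cpow_half_ne_zero (slitPlane_ne_zero hy)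
    refine ((hasDerivAt_P3_cpow hy _).fun_inv h₀).congr_deriv ?_
    simp only [eval_mul, eval_C, eval_neg, eval_ofNat]
    field_simp
  have hD (y : ℂ) (hy : P3 y ∈ slitPlane) : (2 * polyP).eval y ≠ 0 := by
    simpa using polyP_eval_ne_zero (slitPlane_ne_zero hy)
  simpa [sqrtNumerator] using iteratedDeriv_mul_eqOn_jetNumerator hU hD hv 1 k hx

theorem isSolutionAt_div_sqrt_P3_iff {x : ℂ} {Y : ℂ → ℂ} (hx : P3 x ∈ slitPlane)
    (hY : AnalyticAt ℂ Y x) :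
    IsSolutionAt (fun k => (pulledBackODE k).eval) (fun y => Y y / P3 y ^ (1 / 2 : ℂ)) x ↔
      IsSolutionAt (fun k => (normalizedODE k).eval) Y x := by
  have h₀ := P3_cpow_half_ne_zero (slitPlane_ne_zero hx)
  have hP := polyP_eval_ne_zero (slitPlane_ne_zero hx)
  have hv : AnalyticAt ℂ (fun y => (P3 y ^ (1 / 2 : ℂ))⁻¹) x := (analyticAt_P3_cpow hx _).inv h₀
  have hm : 8 * polyP.eval x * (P3 x ^ (1 / 2 : ℂ))⁻¹ ≠ 0 := mul_ne_zero (by simpa) (inv_ne_zero h₀)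
  simp only [div_eq_mul_inv (Y _)]
  rw [isSolutionAt_three_iff, isSolutionAt_three_iff]
  refine (Eq.congr_left ?_).trans (mul_eq_zero_iff_left hm)
  have hleibniz (k : ℕ) := iteratedDeriv_fun_mul (n := k) hY.contDiffAt hv.contDiffAt
  have id₂ := by simpa using congrArg (eval x) normalizedODE_two_identity
  have id₁ := by simpa using congrArg (eval x) normalizedODE_one_identity
  have id₀ := by simpa using congrArg (eval x) normalizedODE_zero_identity
  have id₃ : normalizedODE 3 = polyP ^ 2 * polyT * polyB := rfl
  simp only [hleibniz, iteratedDeriv_inv_sqrt_P3 hx, Finset.sum_range_succ, Finset.sum_range_zero,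
    pulledBackODE, Matrix.cons_val, id₃]
  norm_num [sqrtNumerator_zero, Nat.choose]
  rw [sqrtNumerator_one, eval_neg] at id₀ id₁ ⊢
  generalize (P3 x ^ (1 / 2 : ℂ))⁻¹ = v
  field_simp
  linear_combination 8 * v * Y x * id₀ + 16 * v * polyP.eval x * deriv Y x * id₁ +
    32 * v * polyP.eval x * iteratedDeriv 2 Y x * id₂

end PullBackPsi3

section AlgebraicSolutions

open Polynomial

theorem cpow_half_sq (z : ℂ) : (z ^ (1 / 2 : ℂ)) ^ 2 = z := by
  simp

theorem s7_sq : s7 ^ 2 = 7 := by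
  rw [s7, ← ofReal_pow, Real.sq_sqrt (by norm_num)]
  norm_num

theorem s7_ne_zero : s7 ≠ 0 := fun h => by simpa [h] using s7_sq

theorem add_s7_ne_zero : 21 + 8 * s7 ≠ 0 := fun h => by
  have h' : s7 = -21 / 8 := by linear_combination h / 8
  have h_sq := s7_sq
  norm_num [h'] at h_sq

theorem sub_s7_ne_zero : 21 - 8 * s7 ≠ 0 := fun h => by
  have h' : s7 = 21 / 8 := by linear_combination -h / 8
  have h_sq := s7_sq
  norm_num [h'] at h_sq

theorem S_zero : S 0 = s7 := by
  rw [S, s7, Real.sqrt_eq_rpow, ofReal_cpow (by norm_num)]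
  norm_num

theorem four_mul_S_sq (x : ℂ) : 4 * S x ^ 2 = polyB.eval x := by
  rw [S, cpow_half_sq]
  simp only [polyB, eval_add, eval_sub, eval_mul, eval_pow, eval_X, eval_ofNat]
  ring

theorem derivative_polyB : derivative polyB = 16 * X ^ 3 - 42 * X := by
  simp [polyB, map_ofNat C]
  ring

/-- `s` is a holomorphic branch of `± S` on `U`, and `h` one of `Y₁` for `s = S` and of `Y₂` for
`s = -S`, up to a constant factor. -/
structure IsRadicalPairOn (s h : ℂ → ℂ) (U : Set ℂ) : Prop where
  four_mul_sq : ∀ x ∈ U, 4 * s x ^ 2 = polyB.eval x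
  ne_zero : ∀ x ∈ U, s x ≠ 0
  hasDerivAt_fst : ∀ x ∈ U, HasDerivAt s ((derivative polyB).eval x / (8 * s x)) x
  hasDerivAt_snd : ∀ x ∈ U, HasDerivAt h (-x / (2 * s x) * h x) x

namespace IsRadicalPairOn

variable {s h : ℂ → ℂ} {U : Set ℂ}

/-- `(h, 2 s h)` satisfies `v' = (L / B) v` for this `L`. -/
def system : Matrix (Fin 2) (Fin 2) ℂ[X] := !![0, -X; -X * polyB, 8 * X ^ 3 - 21 * X]

/-- The `k`-th derivative of `(2 x² - 3 x + 2 s) h` is a combination of `h` and `2 s h` with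
coefficients `jet k i / B ^ k`. -/
def jet : ℕ → Fin 2 → ℂ[X] := jetNumerator polyB system ![2 * X ^ 2 - 3 * X, 1]

theorem jet_zero : jet 0 = ![2 * X ^ 2 - 3 * X, 1] := rfl

theorem jet_one : jet 1 =
    ![12 * X ^ 5 - 12 * X ^ 4 - 63 * X ^ 3 + 63 * X ^ 2 + 84 * X - 84,
      6 * X ^ 3 + 3 * X ^ 2 - 21 * X] := by
  ext1 i
  rw [jet, jetNumerator, ← jet, jet_zero]
  fin_cases i <;> simp [system, polyB, map_ofNat C] <;> ring

theorem jet_two : jet 2 =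
    ![24 * X ^ 8 - 12 * X ^ 7 - 294 * X ^ 6 + 63 * X ^ 5 + 1386 * X ^ 4 - 84 * X ^ 3 -
        2940 * X ^ 2 + 2352,
      12 * X ^ 6 + 12 * X ^ 5 - 105 * X ^ 4 - 126 * X ^ 3 + 420 * X ^ 2 + 252 * X - 588] := by
  ext1 i
  rw [jet, jetNumerator, ← jet, jet_one, derivative_polyB]
  fin_cases i <;> simp [system, polyB, map_ofNat C] <;> ring

theorem jet_three : jet 3 =
    ![-48 * X ^ 11 + 1008 * X ^ 9 + 756 * X ^ 8 - 8673 * X ^ 7 - 5985 * X ^ 6 + 35280 * X ^ 5 +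
        15876 * X ^ 4 - 67620 * X ^ 3 - 14112 * X ^ 2 + 49392 * X,
      -24 * X ^ 9 - 36 * X ^ 8 + 378 * X ^ 7 + 945 * X ^ 6 - 3885 * X ^ 5 - 3276 * X ^ 4 +
        14112 * X ^ 3 - 15876 * X + 7056] := by
  ext1 i
  rw [jet, jetNumerator, ← jet, jet_two, derivative_polyB]
  fin_cases i <;> simp [system, polyB, map_ofNat C] <;> ring

theorem sum_normalizedODE_mul_jet (i : Fin 2) :
    ∑ k : Fin 4, normalizedODE k * jet k i * polyB ^ (3 - k : ℕ) = 0 := by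
  fin_cases i <;>
    simp [Fin.sum_univ_four, normalizedODE, jet_zero, jet_one, jet_two, jet_three, polyB, polyP,
      polyT] <;> ring

theorem polyB_ne_zero (hsh : IsRadicalPairOn s h U) {x : ℂ} (hx : x ∈ U) :
    polyB.eval x ≠ 0 := by
  rw [← hsh.four_mul_sq x hx]
  exact mul_ne_zero (by norm_num) (pow_ne_zero 2 (hsh.ne_zero x hx))

theorem hasDerivAt (hsh : IsRadicalPairOn s h U) {x : ℂ} (hx : x ∈ U) (i : Fin 2) :
    HasDerivAt ((![h, fun y => 2 * s y * h y] : Fin 2 → ℂ → ℂ) i)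
      ((∑ j, (system i j).eval x * (![h, fun y => 2 * s y * h y] : Fin 2 → ℂ → ℂ) j x) /
        polyB.eval x) x := by
  have hs := hsh.ne_zero x hx
  have hB := hsh.four_mul_sq x hx
  have hh := hsh.hasDerivAt_snd x hx
  fin_cases i
  · refine hh.congr_deriv ?_
    simp [system, ← hB]
    field_simp
    ring
  · refine (((hsh.hasDerivAt_fst x hx).const_mul 2).fun_mul hh).congr_deriv ?_
    simp [system, ← hB, derivative_polyB]
    field_simp
    ring

theorem sum_eval_mul (x : ℂ) :
    ∑ i, ((![2 * X ^ 2 - 3 * X, 1] : Fin 2 → ℂ[X]) i).eval x *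
        (![h, fun y => 2 * s y * h y] : Fin 2 → ℂ → ℂ) i x =
      (2 * x ^ 2 - 3 * x + 2 * s x) * h x := by
  simp
  ring

theorem isSolutionAt (hsh : IsRadicalPairOn s h U) (hU : IsOpen U) {x : ℂ} (hx : x ∈ U) :
    IsSolutionAt (fun k => (normalizedODE k).eval)
      (fun y => (2 * y ^ 2 - 3 * y + 2 * s y) * h y) x := by
  have hsol := isSolutionAt_sum_mul hU (fun y hy => hsh.polyB_ne_zero hy)
    (fun y hy => hsh.hasDerivAt hy) sum_normalizedODE_mul_jet hx
  simpa only [sum_eval_mul] using hsol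

theorem iteratedDeriv_eq (hsh : IsRadicalPairOn s h U) (hU : IsOpen U) {x : ℂ} (hx : x ∈ U)
    (k : ℕ) : iteratedDeriv k (fun y => (2 * y ^ 2 - 3 * y + 2 * s y) * h y) x =
      ((jet k 0).eval x * h x + (jet k 1).eval x * (2 * s x * h x)) / polyB.eval x ^ k := by
  have hjet := iteratedDeriv_eqOn_jetNumerator hU (fun y hy => hsh.polyB_ne_zero hy)
    (fun y hy => hsh.hasDerivAt hy) ![2 * X ^ 2 - 3 * X, 1] k hx
  simp only [sum_eval_mul] at hjet
  simp only [Fin.sum_univ_two] at hjet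
  exact hjet

end IsRadicalPairOn

end AlgebraicSolutions

section Radicals

open Polynomial

/-- The points near `0` that the argument allows: there the radicals are holomorphic, the series in
`Ψ₃` converges, and `Ψ₃` is unramified except at `0`. -/
structure IsTameAt (x : ℂ) : Prop where
  P3_mem : P3 x ∈ slitPlane
  Y0_mem : 1 - 2 * x / 3 ∈ slitPlane
  S_mem : 7 - 21 / 4 * x ^ 2 + x ^ 4 ∈ slitPlane
  Y1_mem : (21 - 8 * x ^ 2 + 8 * S x) / (21 + 8 * s7) ∈ slitPlane
  Y2_mem : (21 - 8 * x ^ 2 - 8 * S x) / (21 - 8 * s7) ∈ slitPlane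
  polyA_ne_zero : polyA.eval x ≠ 0
  polyR_ne_zero : polyR.eval x ≠ 0
  norm_Psi3_lt_one : ‖Psi3 x‖ < 1

theorem S_ne_zero {x : ℂ} (hx : 7 - 21 / 4 * x ^ 2 + x ^ 4 ∈ slitPlane) : S x ≠ 0 := fun hS => by
  refine slitPlane_ne_zero hx ?_
  rw [← cpow_half_sq (7 - 21 / 4 * x ^ 2 + x ^ 4), ← S, hS]
  simp

theorem hasDerivAt_S {x : ℂ} (hx : 7 - 21 / 4 * x ^ 2 + x ^ 4 ∈ slitPlane) :
    HasDerivAt S ((derivative polyB).eval x / (8 * S x)) x := by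
  have hS := S_ne_zero hx
  have hradicand (y : ℂ) : 7 - 21 / 4 * y ^ 2 + y ^ 4 = polyB.eval y / 4 := by
    simp [polyB]
    ring
  have hderiv : HasDerivAt (fun y : ℂ => 7 - 21 / 4 * y ^ 2 + y ^ 4)
      ((derivative polyB).eval x / 4) x := by
    simpa only [hradicand] using (polyB.hasDerivAt x).div_const 4
  refine (hasDerivAt_cpow_const_of_mem_slitPlane (1 / 2) hderiv hx).congr_deriv ?_
  have hS_sq : 7 - 21 / 4 * x ^ 2 + x ^ 4 = S x ^ 2 := by rw [hradicand, ← four_mul_S_sq]; ring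
  rw [← S, hS_sq]
  field_simp
  ring

/-- Up to the sign of `s`, the functions `Y₁` and `Y₂` are given by the same formula. -/
theorem hasDerivAt_quarterRoot {s : ℂ → ℂ} {c x : ℂ}
    (hs : HasDerivAt s ((derivative polyB).eval x / (8 * s x)) x)
    (hx : (21 - 8 * x ^ 2 + 8 * s x) / c ∈ slitPlane) (hs₀ : s x ≠ 0) :
    HasDerivAt (fun y => ((21 - 8 * y ^ 2 + 8 * s y) / c) ^ (1 / 4 : ℂ))
      (-x / (2 * s x) * ((21 - 8 * x ^ 2 + 8 * s x) / c) ^ (1 / 4 : ℂ)) x := by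
  obtain ⟨hnum, hc⟩ := div_ne_zero_iff.1 (slitPlane_ne_zero hx)
  have hderiv := (((((hasDerivAt_pow 2 x).const_mul 8).const_sub 21)).fun_add
    (hs.const_mul 8)).div_const c
  refine (hasDerivAt_cpow_const_of_mem_slitPlane (1 / 4) hderiv hx).congr_deriv ?_
  rw [derivative_polyB]
  simp only [eval_sub, eval_mul, eval_pow, eval_X, eval_ofNat]
  field_simp
  ring

theorem isRadicalPairOn_S_Y1 {U : Set ℂ} (hU : ∀ x ∈ U, IsTameAt x) : IsRadicalPairOn S Y1 U where
  four_mul_sq x _ := four_mul_S_sq x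
  ne_zero x hx := S_ne_zero (hU x hx).S_mem
  hasDerivAt_fst x hx := hasDerivAt_S (hU x hx).S_mem
  hasDerivAt_snd x hx := hasDerivAt_quarterRoot (hasDerivAt_S (hU x hx).S_mem) (hU x hx).Y1_mem
    (S_ne_zero (hU x hx).S_mem)

theorem isRadicalPairOn_neg_S_Y2 {U : Set ℂ} (hU : ∀ x ∈ U, IsTameAt x) :
    IsRadicalPairOn (fun x => -S x) Y2 U where
  four_mul_sq x _ := by rw [neg_sq, four_mul_S_sq]
  ne_zero x hx := neg_ne_zero.2 (S_ne_zero (hU x hx).S_mem)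
  hasDerivAt_fst x hx := by
    simpa only [mul_neg, div_neg] using (hasDerivAt_S (hU x hx).S_mem).fun_neg
  hasDerivAt_snd x hx := by
    have hS := hasDerivAt_S (hU x hx).S_mem
    have hY2 := (hU x hx).Y2_mem
    simp only [sub_eq_add_neg _ (8 * S x), ← mul_neg] at hY2
    have hderiv := hasDerivAt_quarterRoot (s := fun x => -S x)
      (by simpa only [mul_neg, div_neg] using hS.fun_neg) hY2
      (neg_ne_zero.2 (S_ne_zero (hU x hx).S_mem))
    simp only [mul_neg, ← sub_eq_add_neg] at hderiv ⊢
    exact hderiv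

theorem hasDerivAt_Y0 {x : ℂ} (hx : 1 - 2 * x / 3 ∈ slitPlane) :
    HasDerivAt Y0 ((-1 : ℂ[X]).eval x * Y0 x / polyT.eval x) x := by
  have hderiv : HasDerivAt (fun y : ℂ => 1 - 2 * y / 3) (-(2 * 1 / 3)) x :=
    (((hasDerivAt_id x).const_mul 2).div_const 3).const_sub 1
  have hT : polyT.eval x = 3 * (1 - 2 * x / 3) := by
    simp [polyT]
    ring
  have hne := slitPlane_ne_zero hx
  refine (hasDerivAt_cpow_const_of_mem_slitPlane (1 / 2) hderiv hx).congr_deriv ?_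
  rw [hT, Y0]
  generalize 1 - 2 * x / 3 = t at hne
  simp
  field_simp

theorem polyT_eval_ne_zero {x : ℂ} (hx : 1 - 2 * x / 3 ∈ slitPlane) : polyT.eval x ≠ 0 :=
  fun hT => by
  refine slitPlane_ne_zero hx ?_
  simp [polyT] at hT
  linear_combination hT / 3

end Radicals

section AlgebraicBasis

open Polynomial

variable {U : Set ℂ}

/-- The algebraic solutions `x Y₀`, `W₁ Y₁`, `W₂ Y₂`. -/
def algebraicBasis : Fin 3 → ℂ → ℂ :=
  ![fun x => x * Y0 x, fun x => W1 x * Y1 x, fun x => W2 x * Y2 x]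

/-- The `k`-th derivative of `x Y₀` is `linearRootNumerator k / T ^ k * Y₀`. -/
def linearRootNumerator (k : ℕ) : ℂ[X] :=
  jetNumerator polyT (fun _ _ : Unit => -1) (fun _ => X) k ()

theorem derivative_polyT : derivative polyT = -2 := by
  simp [polyT]

theorem linearRootNumerator_zero : linearRootNumerator 0 = X := rfl

theorem linearRootNumerator_one : linearRootNumerator 1 = 3 - 3 * X := by
  rw [linearRootNumerator, jetNumerator_unit_succ, ← linearRootNumerator,
    linearRootNumerator_zero, derivative_polyT, polyT, derivative_X]
  push_cast
  ring

theorem linearRootNumerator_two : linearRootNumerator 2 = 3 * X - 6 := by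
  rw [linearRootNumerator, jetNumerator_unit_succ, ← linearRootNumerator,
    linearRootNumerator_one, derivative_polyT, polyT]
  simp
  ring

theorem linearRootNumerator_three : linearRootNumerator 3 = 3 * X - 9 := by
  rw [linearRootNumerator, jetNumerator_unit_succ, ← linearRootNumerator,
    linearRootNumerator_two, derivative_polyT, polyT]
  simp
  ring

theorem sum_normalizedODE_mul_linearRootNumerator :
    ∑ k : Fin 4, normalizedODE k * linearRootNumerator k * polyT ^ (3 - k : ℕ) = 0 := by
  simp [Fin.sum_univ_four, normalizedODE, linearRootNumerator_zero, linearRootNumerator_one,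
    linearRootNumerator_two, linearRootNumerator_three, polyB, polyP, polyT]
  ring

theorem isSolutionAt_mul_Y0 (hU : IsOpen U) (ht : ∀ x ∈ U, IsTameAt x) {x : ℂ} (hx : x ∈ U) :
    IsSolutionAt (fun k => (normalizedODE k).eval) (fun y => y * Y0 y) x := by
  have hsol := isSolutionAt_sum_mul hU (fun y hy => polyT_eval_ne_zero (ht y hy).Y0_mem)
    (L := fun _ _ : Unit => -1) (v := fun _ => Y0) (p := fun _ => X) (a := normalizedODE)
    (by simpa using fun y hy => hasDerivAt_Y0 (ht y hy).Y0_mem)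
    (fun _ => sum_normalizedODE_mul_linearRootNumerator) hx
  simpa using hsol

theorem W1_mul_Y1 (x : ℂ) :
    W1 x * Y1 x = 1 / (2 * s7) * ((2 * x ^ 2 - 3 * x + 2 * S x) * Y1 x) := by
  rw [W1]
  ring

theorem W2_mul_Y2 (x : ℂ) :
    W2 x * Y2 x = -1 / (2 * s7) * ((2 * x ^ 2 - 3 * x + 2 * -S x) * Y2 x) := by
  rw [W2]
  ring

theorem isSolutionAt_algebraicBasis (hU : IsOpen U) (ht : ∀ x ∈ U, IsTameAt x) {x : ℂ}
    (hx : x ∈ U) (i : Fin 3) :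
    IsSolutionAt (fun k => (normalizedODE k).eval) (algebraicBasis i) x := by
  have h₁ := ((isRadicalPairOn_S_Y1 ht).isSolutionAt hU hx).const_mul (1 / (2 * s7))
  have h₂ := ((isRadicalPairOn_neg_S_Y2 ht).isSolutionAt hU hx).const_mul (-1 / (2 * s7))
  simp only [← W1_mul_Y1, ← W2_mul_Y2] at h₁ h₂
  fin_cases i
  exacts [isSolutionAt_mul_Y0 hU ht hx, h₁, h₂]

theorem analyticOnNhd_algebraicBasis (hU : IsOpen U) (ht : ∀ x ∈ U, IsTameAt x) (i : Fin 3) :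
    AnalyticOnNhd ℂ (algebraicBasis i) U := by
  refine DifferentiableOn.analyticOnNhd (fun x hx => DifferentiableAt.differentiableWithinAt ?_) hU
  have hS := (hasDerivAt_S (ht x hx).S_mem).differentiableAt
  have hY0 := (hasDerivAt_Y0 (ht x hx).Y0_mem).differentiableAt
  have hY1 := ((isRadicalPairOn_S_Y1 ht).hasDerivAt_snd x hx).differentiableAt
  have hY2 := ((isRadicalPairOn_neg_S_Y2 ht).hasDerivAt_snd x hx).differentiableAt
  have hW1 : DifferentiableAt ℂ W1 x := by unfold W1; fun_prop
  have hW2 : DifferentiableAt ℂ W2 x := by unfold W2; fun_prop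
  fin_cases i
  exacts [differentiableAt_id.fun_mul hY0, hW1.fun_mul hY1, hW2.fun_mul hY2]

theorem isTameAt_zero : IsTameAt 0 where
  P3_mem := by norm_num [P3]
  Y0_mem := by norm_num
  S_mem := by norm_num [mem_slitPlane_iff]
  Y1_mem := by norm_num [S_zero, div_self add_s7_ne_zero]
  Y2_mem := by norm_num [S_zero, div_self sub_s7_ne_zero]
  polyA_ne_zero := by norm_num [polyA]
  polyR_ne_zero := by norm_num [polyR]
  norm_Psi3_lt_one := by norm_num [Psi3]

theorem eventually_isTameAt : ∀ᶠ x in 𝓝 (0 : ℂ), IsTameAt x := by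
  have h₀ := isTameAt_zero
  have hS : ContinuousAt S 0 := (hasDerivAt_S h₀.S_mem).continuousAt
  have hΨ : ContinuousAt Psi3 0 :=
    (hasDerivAt_Psi3 (polyP_eval_ne_zero (slitPlane_ne_zero h₀.P3_mem))).continuousAt
  have hslit (f : ℂ → ℂ) (hf : ContinuousAt f 0) (hf₀ : f 0 ∈ slitPlane) :
      ∀ᶠ x in 𝓝 0, f x ∈ slitPlane := hf.eventually_mem (isOpen_slitPlane.mem_nhds hf₀)
  filter_upwards [hslit P3 (by unfold P3; fun_prop) h₀.P3_mem,
    hslit (fun x => 1 - 2 * x / 3) (by fun_prop) h₀.Y0_mem,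
    hslit (fun x => 7 - 21 / 4 * x ^ 2 + x ^ 4) (by fun_prop) h₀.S_mem,
    hslit (fun x => (21 - 8 * x ^ 2 + 8 * S x) / (21 + 8 * s7)) (by fun_prop) h₀.Y1_mem,
    hslit (fun x => (21 - 8 * x ^ 2 - 8 * S x) / (21 - 8 * s7)) (by fun_prop) h₀.Y2_mem,
    polyA.continuousAt.eventually_ne h₀.polyA_ne_zero,
    polyR.continuousAt.eventually_ne h₀.polyR_ne_zero,
    hΨ.norm.eventually_lt_const h₀.norm_Psi3_lt_one] with x hP hY0 hS hY1 hY2 hA hR hΨ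
  exact ⟨hP, hY0, hS, hY1, hY2, hA, hR, hΨ⟩

theorem wronskianMatrix_algebraicBasis_zero : wronskianMatrix algebraicBasis 0 =
    !![0, 1, 1;
      1, -3 / (2 * s7), 3 / (2 * s7);
      -2 / 3, 3 / (2 * s7) - 3 / 4, -3 / (2 * s7) - 3 / 4] := by
  have hs7 := s7_ne_zero
  obtain ⟨U, ht, hU, h₀⟩ := eventually_nhds_iff.1 eventually_isTameAt
  have hY0 (k : ℕ) : iteratedDeriv k (fun x => x * Y0 x) 0 =
      (linearRootNumerator k).eval 0 / polyT.eval 0 ^ k := by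
    have hjet := iteratedDeriv_mul_eqOn_jetNumerator hU
      (fun y hy => polyT_eval_ne_zero (ht y hy).Y0_mem)
      (fun y hy => hasDerivAt_Y0 (ht y hy).Y0_mem) X k h₀
    simpa [Y0, linearRootNumerator] using hjet
  have hY1 (k : ℕ) : iteratedDeriv k (fun x => W1 x * Y1 x) 0 = 1 / (2 * s7) *
      (((IsRadicalPairOn.jet k 0).eval 0 + (IsRadicalPairOn.jet k 1).eval 0 * (2 * s7)) /
        polyB.eval 0 ^ k) := by
    simp_rw [W1_mul_Y1, iteratedDeriv_const_mul_field]
    rw [(isRadicalPairOn_S_Y1 ht).iteratedDeriv_eq hU h₀]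
    simp [S_zero, Y1, div_self add_s7_ne_zero]
  have hY2 (k : ℕ) : iteratedDeriv k (fun x => W2 x * Y2 x) 0 = -1 / (2 * s7) *
      (((IsRadicalPairOn.jet k 0).eval 0 + (IsRadicalPairOn.jet k 1).eval 0 * (2 * -s7)) /
        polyB.eval 0 ^ k) := by
    simp_rw [W2_mul_Y2, iteratedDeriv_const_mul_field]
    rw [(isRadicalPairOn_neg_S_Y2 ht).iteratedDeriv_eq hU h₀]
    simp [S_zero, Y2, div_self sub_s7_ne_zero]
  ext i j
  fin_cases i <;> fin_cases j <;>
    simp [wronskianMatrix, algebraicBasis, hY0, hY1, hY2, linearRootNumerator_zero,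
      linearRootNumerator_one, linearRootNumerator_two, IsRadicalPairOn.jet_zero,
      IsRadicalPairOn.jet_one, IsRadicalPairOn.jet_two, polyT, polyB, -iteratedDeriv_zero,
      -iteratedDeriv_one] <;> field_simp <;> ring

theorem det_wronskianMatrix_algebraicBasis_zero :
    (wronskianMatrix algebraicBasis 0).det = 1 / s7 := by
  have hs7 := s7_ne_zero
  rw [wronskianMatrix_algebraicBasis_zero]
  simp [Matrix.det_fin_three]
  field_simp
  ring

theorem exists_ball_isTameAt : ∃ r : ℝ, 0 < r ∧ ∀ x ∈ Metric.ball (0 : ℂ) r,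
    IsTameAt x ∧ (wronskianMatrix algebraicBasis x).det ≠ 0 := by
  obtain ⟨U, ht, hU, h₀⟩ := eventually_nhds_iff.1 eventually_isTameAt
  have hdet : ContinuousAt (fun x => (wronskianMatrix algebraicBasis x).det) 0 :=
    (differentiableAt_det (differentiableAt_wronskianMatrix fun j =>
      analyticOnNhd_algebraicBasis hU ht j 0 h₀)).continuousAt
  refine Metric.eventually_nhds_iff_ball.1 (eventually_isTameAt.and (hdet.eventually_ne ?_))
  rw [det_wronskianMatrix_algebraicBasis_zero]
  exact one_div_ne_zero s7_ne_zero

end AlgebraicBasis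

section PullBackBasis

open Polynomial

variable {U : Set ℂ}

theorem IsTameAt.polyP_eval_ne_zero {x : ℂ} (hx : IsTameAt x) : polyP.eval x ≠ 0 :=
  Darboux3B.polyP_eval_ne_zero (slitPlane_ne_zero hx.P3_mem)

theorem IsTameAt.deriv_Psi3_ne_zero_iff {x : ℂ} (hx : IsTameAt x) : deriv Psi3 x ≠ 0 ↔ x ≠ 0 := by
  simp [(hasDerivAt_Psi3 hx.polyP_eval_ne_zero).deriv, hx.polyP_eval_ne_zero, hx.polyA_ne_zero,
    hx.polyR_ne_zero]

theorem IsTameAt.hypEqAt_div_sqrt_P3_iff {x : ℂ} {Y : ℂ → ℂ} (hx : IsTameAt x) (hx₀ : x ≠ 0)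
    (hY : AnalyticAt ℂ Y x) :
    HypEqAt (-1 / 14) (3 / 14) (5 / 14) (1 / 3) (2 / 3) Psi3
        (fun t => Y t / P3 t ^ (1 / 2 : ℂ)) x ↔
      IsSolutionAt (fun k => (normalizedODE k).eval) Y x := by
  have h₀ := P3_cpow_half_ne_zero (slitPlane_ne_zero hx.P3_mem)
  rw [hypEqAt_Psi3_iff hx₀ hx.polyP_eval_ne_zero hx.polyA_ne_zero hx.polyR_ne_zero
    (hY.fun_div (analyticAt_P3_cpow hx.P3_mem _) h₀), isSolutionAt_div_sqrt_P3_iff hx.P3_mem hY]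

theorem IsTameAt.normalizedODE_last_eval_ne_zero {x : ℂ} (hx : IsTameAt x) :
    (normalizedODE (Fin.last 3)).eval x ≠ 0 := by
  have h : normalizedODE (Fin.last 3) = polyP ^ 2 * polyT * polyB := rfl
  have hB : polyB.eval x ≠ 0 := by simp [← four_mul_S_sq, S_ne_zero hx.S_mem]
  rw [h]
  simp [hx.polyP_eval_ne_zero, polyT_eval_ne_zero hx.Y0_mem, hB]

theorem isSolutionAt_normalizedODE_of_forall_ne_zero (hU : IsOpen U) {Y : ℂ → ℂ}
    (hY : AnalyticOnNhd ℂ Y U)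
    (h : ∀ x ∈ U, x ≠ 0 → IsSolutionAt (fun k => (normalizedODE k).eval) Y x) {x : ℂ}
    (hx : x ∈ U) : IsSolutionAt (fun k => (normalizedODE k).eval) Y x := by
  obtain rfl | hx₀ := eq_or_ne x 0
  · refine isSolutionAt_of_eventually_nhdsNE (fun k => (normalizedODE k).continuousAt) (hY 0 hx) ?_
    filter_upwards [nhdsWithin_le_nhds (hU.eventually_mem hx), self_mem_nhdsWithin] using h
  · exact h x hx hx₀

theorem isPullbackSolutionOn_iff (hU : IsOpen U) (ht : ∀ x ∈ U, IsTameAt x) {Y : ℂ → ℂ} :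
    IsPullbackSolutionOn (-1 / 14) (3 / 14) (5 / 14) (1 / 3) (2 / 3)
        (fun x => P3 x ^ (1 / 2 : ℂ)) Psi3 U Y ↔
      AnalyticOnNhd ℂ Y U ∧ ∀ x ∈ U, IsSolutionAt (fun k => (normalizedODE k).eval) Y x := by
  rw [IsPullbackSolutionOn, ← analyticOnNhd_iff_differentiableOn hU]
  refine and_congr_right fun hY => ⟨fun h x hx => ?_, fun h x hx hΨ' _ => ?_⟩
  · refine isSolutionAt_normalizedODE_of_forall_ne_zero hU hY (fun t htU ht₀ => ?_) hx
    exact ((ht t htU).hypEqAt_div_sqrt_P3_iff ht₀ (hY t htU)).1 (h t htU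
      ((ht t htU).deriv_Psi3_ne_zero_iff.2 ht₀)
      (P3_cpow_half_ne_zero (slitPlane_ne_zero (ht t htU).P3_mem)))
  · exact ((ht x hx).hypEqAt_div_sqrt_P3_iff ((ht x hx).deriv_Psi3_ne_zero_iff.1 hΨ')
      (hY x hx)).2 (h x hx)

theorem isPullbackSolutionBasisNearZero_algebraicBasis :
    IsPullbackSolutionBasisNearZero (-1 / 14) (3 / 14) (5 / 14) (1 / 3) (2 / 3)
      (fun x => P3 x ^ (1 / 2 : ℂ)) Psi3 algebraicBasis := by
  obtain ⟨r, hr, hball⟩ := exists_ball_isTameAt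
  refine ⟨r, hr, fun U hU hUc hUr => ?_⟩
  have ht (x) (hx : x ∈ U) : IsTameAt x := (hball x (hUr hx)).1
  have hW (x) (hx : x ∈ U) : (wronskianMatrix algebraicBasis x).det ≠ 0 := (hball x (hUr hx)).2
  have hu := analyticOnNhd_algebraicBasis hU ht
  have husol (x) (hx : x ∈ U) := isSolutionAt_algebraicBasis hU ht hx
  refine ⟨fun Y => ?_, fun c hc => ?_⟩
  · rw [isPullbackSolutionOn_iff hU ht]
    constructor
    · rintro ⟨hY, hYsol⟩
      exact exists_eqOn_linearCombination hU hUc.isPreconnected hu hY hW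
        (fun x hx => (ht x hx).normalizedODE_last_eval_ne_zero) husol hYsol
    · rintro ⟨c, hc⟩
      have hcomb : AnalyticOnNhd ℂ (fun x => ∑ j, c j * algebraicBasis j x) U := fun x hx =>
        Finset.analyticAt_fun_sum _ fun j _ => analyticAt_const.fun_mul (hu j x hx)
      refine ⟨hcomb.congr hU fun x hx => (hc x hx).symm, fun x hx => ?_⟩
      rw [isSolutionAt_congr ((hU.eventually_mem hx).mono hc)]
      exact IsSolutionAt.linearCombination (fun j => hu j x hx) (husol x hx) c
  · obtain ⟨x, hx⟩ := hUc.nonempty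
    exact eq_zero_of_linearCombination_eqOn_zero hU hx (fun j => hu j x hx) (hW x hx) hc

end PullBackBasis

section HypergeometricSolutions

open Polynomial

/-- The factor `xᵏ Q₃ᵏ P₃ ^ (1 / 2 - 7 k / 3)` of the solution of local exponent `k` at `0`: up
to a constant it is `√P₃ * Ψ₃ ^ (k / 3)`, freed of its fractional powers of `x Q₃`. -/
def prefactor (k : ℕ) (x : ℂ) : ℂ := (x * Q3 x) ^ k * P3 x ^ (1 / 2 - 7 * k / 3 : ℂ)

theorem analyticAt_mul_Q3_pow_mul_P3_cpow {x : ℂ} (hx : P3 x ∈ slitPlane) (k : ℕ) (c : ℂ) :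
    AnalyticAt ℂ (fun y => (y * Q3 y) ^ k * P3 y ^ c) x := by
  have hQ : AnalyticAt ℂ (fun y => (y * Q3 y) ^ k) x := by unfold Q3; fun_prop
  exact hQ.fun_mul (analyticAt_P3_cpow hx c)

theorem hasDerivAt_mul_Q3 (x : ℂ) : HasDerivAt (fun y => y * Q3 y)
    (-(polyA.eval x + x * (derivative polyA).eval x) / 1372) x := by
  have h := ((hasDerivAt_id x).fun_mul (polyA.hasDerivAt x)).fun_neg.div_const 1372
  refine (h.congr_of_eventuallyEq (.of_forall fun y => ?_)).congr_deriv ?_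
  · simp only [Q3_eq, id]
    ring
  · simp only [one_mul, id]

/-- `(x Q₃)ᵏ P₃ ^ (-7 k / 3)` is a constant multiple of a branch of `Ψ₃ ^ (k / 3)`. -/
theorem pullEuler_Psi3_mul_Q3_pow_mul_P3_cpow {x : ℂ} (hx : x ≠ 0) (hP3 : P3 x ∈ slitPlane)
    (hA : polyA.eval x ≠ 0) (hR : polyR.eval x ≠ 0) (k : ℕ) :
    pullEuler Psi3 (-(k / 3)) (fun y => (y * Q3 y) ^ k * P3 y ^ (-(7 * k / 3) : ℂ)) x = 0 := by
  have hP := polyP_eval_ne_zero (slitPlane_ne_zero hP3)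
  have hg := ((hasDerivAt_mul_Q3 x).fun_pow k).fun_mul (hasDerivAt_P3_cpow hP3 (-(7 * k / 3) : ℂ))
  rw [pullEuler, pullDeriv, mul_div_left_comm, Psi3_div_deriv hx hP hA hR, hg.deriv, Q3_eq]
  cases k with
  | zero => simp
  | succ k =>
    simp only [pow_succ, eval_mul, eval_C, Nat.cast_add, Nat.cast_one, Nat.add_sub_cancel]
    generalize P3 x ^ (_ : ℂ) = v
    field_simp
    linear_combination -((k + 1) * x * x ^ k * polyA.eval x * polyA.eval x ^ k * v *
      (-1 / 1372) ^ k) * eval_logDeriv_numerator x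

theorem three_le_analyticOrderAt_Psi3 : 3 ≤ analyticOrderAt Psi3 0 := by
  have h : AnalyticAt ℂ Psi3 0 := by unfold Psi3; fun_prop (disch := norm_num)
  refine (natCast_le_analyticOrderAt h (n := 3)).2
    ⟨fun x => polyA.eval x ^ 3 / (1728 * polyP.eval x ^ 7), ?_, .of_forall fun x => ?_⟩
  · have hA := polyA.differentiable.analyticAt 0
    have hP := polyP.differentiable.analyticAt 0
    fun_prop (disch := norm_num [polyP])
  · rw [Psi3_eq, sub_zero, smul_eq_mul, mul_div_assoc]

theorem three_le_analyticOrderAt_hyp32_Psi3_sub_one (a₁ a₂ a₃ b₁ b₂ : ℂ) :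
    3 ≤ analyticOrderAt (fun x => hyp32 a₁ a₂ a₃ b₁ b₂ (Psi3 x) - 1) 0 := by
  have hΨ : Psi3 0 = 0 := by simp [Psi3]
  have hΨa : AnalyticAt ℂ Psi3 0 := by unfold Psi3; fun_prop (disch := norm_num)
  have hF : AnalyticAt ℂ (fun z => hyp32 a₁ a₂ a₃ b₁ b₂ z - 1) (Psi3 0) :=
    ((isPowerSeriesOnDisc_hyp32 a₁ a₂ a₃ b₁ b₂).analyticAt (by simp [hΨ])).fun_sub analyticAt_const
  have hF₀ : 1 ≤ analyticOrderAt (fun z => hyp32 a₁ a₂ a₃ b₁ b₂ z - 1) (Psi3 0) := by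
    rw [Order.one_le_iff_ne_zero, hF.analyticOrderAt_ne_zero, hΨ, hyp32_zero, sub_self]
  have hcomp := hF.analyticOrderAt_comp hΨa
  simp only [hΨ, sub_zero] at hcomp hF₀
  calc 3 ≤ analyticOrderAt Psi3 0 := three_le_analyticOrderAt_Psi3
    _ ≤ _ * analyticOrderAt Psi3 0 := le_mul_of_one_le_left zero_le hF₀
    _ = _ := hcomp.symm

theorem prefactor_div_sqrt_P3 {x : ℂ} (hx : P3 x ≠ 0) (k : ℕ) :
    prefactor k x / P3 x ^ (1 / 2 : ℂ) = (x * Q3 x) ^ k * P3 x ^ (-(7 * k / 3) : ℂ) := by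
  rw [prefactor, sub_eq_add_neg, cpow_add _ _ hx, div_eq_iff (P3_cpow_half_ne_zero hx)]
  ring

theorem analyticAt_prefactor {x : ℂ} (hx : P3 x ∈ slitPlane) (k : ℕ) :
    AnalyticAt ℂ (prefactor k) x :=
  analyticAt_mul_Q3_pow_mul_P3_cpow hx k _

theorem analyticAt_hyp32_Psi3 {x : ℂ} (hx : IsTameAt x) (a₁ a₂ a₃ b₁ b₂ : ℂ) :
    AnalyticAt ℂ (fun y => hyp32 a₁ a₂ a₃ b₁ b₂ (Psi3 y)) x :=
  ((isPowerSeriesOnDisc_hyp32 a₁ a₂ a₃ b₁ b₂).analyticAt hx.norm_Psi3_lt_one).fun_comp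
    (analyticAt_Psi3 hx.polyP_eval_ne_zero)

variable {b₁ b₂ : ℂ}

theorem isSolutionAt_prefactor_mul_hyp32 {k : ℕ} {x : ℂ} (hx : IsTameAt x) (hx₀ : x ≠ 0)
    (hb₁ : ∀ n : ℕ, b₁ + n ≠ 0) (hb₂ : ∀ n : ℕ, b₂ + n ≠ 0)
    (hindicial : ∀ t : ℂ, (t + k / 3) * (t + (1 / 3 - 1 + k / 3)) * (t + (2 / 3 - 1 + k / 3)) =
      t * (t + b₁ - 1) * (t + b₂ - 1)) :
    IsSolutionAt (fun k => (normalizedODE k).eval) (fun y => prefactor k y *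
      hyp32 (-1 / 14 + k / 3) (3 / 14 + k / 3) (5 / 14 + k / 3) b₁ b₂ (Psi3 y)) x := by
  have hP := hx.polyP_eval_ne_zero
  have hΨ : Psi3 x ≠ 0 := by simp [Psi3_eq, hx₀, hx.polyA_ne_zero, hP]
  have hga := analyticAt_mul_Q3_pow_mul_P3_cpow hx.P3_mem k (-(7 * k / 3) : ℂ)
  have hge : pullEuler Psi3 (-(k / 3)) (fun y => (y * Q3 y) ^ k * P3 y ^ (-(7 * k / 3) : ℂ))
      =ᶠ[𝓝 x] 0 := by
    filter_upwards [eventually_ne_nhds hx₀, eventually_P3_mem_slitPlane hx.P3_mem,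
      polyA.continuousAt.eventually_ne hx.polyA_ne_zero,
      polyR.continuousAt.eventually_ne hx.polyR_ne_zero] with y hy hP3 hA hR
    exact pullEuler_Psi3_mul_Q3_pow_mul_P3_cpow hy hP3 hA hR k
  have hhyp := hypEqAt_mul_hyp32_comp (a₁ := -1 / 14) (a₂ := 3 / 14) (a₃ := 5 / 14)
    (analyticAt_Psi3 hP) hΨ (hx.deriv_Psi3_ne_zero_iff.2 hx₀) hx.norm_Psi3_lt_one hga hge hb₁ hb₂
    hindicial
  rw [hypEqAt_Psi3_iff hx₀ hP hx.polyA_ne_zero hx.polyR_ne_zero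
    (hga.fun_mul (analyticAt_hyp32_Psi3 hx _ _ _ _ _))] at hhyp
  rw [← isSolutionAt_div_sqrt_P3_iff hx.P3_mem
    ((analyticAt_prefactor hx.P3_mem k).fun_mul (analyticAt_hyp32_Psi3 hx _ _ _ _ _))]
  refine (isSolutionAt_congr ?_).1 hhyp
  filter_upwards [eventually_P3_mem_slitPlane hx.P3_mem] with y hy
  rw [← prefactor_div_sqrt_P3 (slitPlane_ne_zero hy), div_mul_eq_mul_div]

theorem prefactor_eq (k : ℕ) (x : ℂ) : prefactor k x =
    ((C (-1 / 1372) * X * polyA) ^ k).eval x * P3 x ^ (1 / 2 - 7 * k / 3 : ℂ) := by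
  rw [prefactor, Q3_eq, eval_pow, eval_mul, eval_mul, eval_C, eval_X]
  ring

theorem iteratedDeriv_prefactor_zero (k i : ℕ) : iteratedDeriv i (prefactor k) 0 =
    (jetNumerator polyP (fun _ _ : Unit => C (1 / 2 - 7 * k / 3 : ℂ) * derivative polyP)
      (fun _ => (C (-1 / 1372) * X * polyA) ^ k) i ()).eval 0 / 7 ^ i := by
  have hU : IsOpen (P3 ⁻¹' slitPlane) := isOpen_slitPlane.preimage (by unfold P3; fun_prop)
  have h := iteratedDeriv_mul_eqOn_jetNumerator hU
    (fun y hy => polyP_eval_ne_zero (slitPlane_ne_zero hy))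
    (fun y hy => hasDerivAt_P3_cpow hy (1 / 2 - 7 * k / 3 : ℂ))
    ((C (-1 / 1372) * X * polyA) ^ k) i isTameAt_zero.P3_mem
  have hP3 : P3 0 = 1 := by simp [P3]
  have hP : polyP.eval 0 = 7 := by simp [polyP]
  simp only [← prefactor_eq, hP3, one_cpow, mul_one, hP] at h
  exact h

/-- The coordinates of the three hypergeometric solutions in `algebraicBasis`. -/
def connectionMatrix : Matrix (Fin 3) (Fin 3) ℂ :=
  !![0, (3 + s7) / 6, (3 - s7) / 6;
    1 / 2, -s7 / 6, s7 / 6;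
    6, 2 * s7, -(2 * s7)]

theorem iteratedDeriv_prefactor_zero_eq (k i : Fin 3) : iteratedDeriv i (prefactor k) 0 =
    !![1, -1 / 2, -1 / 4; 0, 1, -5 / 6; 0, 0, 2] k i := by
  rw [iteratedDeriv_prefactor_zero]
  fin_cases k <;> fin_cases i <;> simp [jetNumerator, pow_two, polyP, polyA] <;> norm_num

theorem iteratedDeriv_prefactor_zero_eq_sum (k i : Fin 3) : iteratedDeriv i (prefactor k) 0 =
    ∑ j, connectionMatrix k j * iteratedDeriv i (algebraicBasis j) 0 := by
  have hW (j) : iteratedDeriv i (algebraicBasis j) 0 = wronskianMatrix algebraicBasis 0 i j := rfl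
  have hs7 := s7_ne_zero
  simp only [hW, wronskianMatrix_algebraicBasis_zero, iteratedDeriv_prefactor_zero_eq,
    connectionMatrix]
  fin_cases k <;> fin_cases i <;> simp [Fin.sum_univ_three] <;> field_simp <;>
    norm_num [s7_sq] <;> ring

theorem eventually_prefactor_mul_hyp32_eq {k : Fin 3} (hb₁ : ∀ n : ℕ, b₁ + n ≠ 0)
    (hb₂ : ∀ n : ℕ, b₂ + n ≠ 0)
    (hindicial : ∀ t : ℂ, (t + k / 3) * (t + (1 / 3 - 1 + k / 3)) * (t + (2 / 3 - 1 + k / 3)) =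
      t * (t + b₁ - 1) * (t + b₂ - 1)) :
    ∀ᶠ x in 𝓝 0, prefactor k x *
        hyp32 (-1 / 14 + k / 3) (3 / 14 + k / 3) (5 / 14 + k / 3) b₁ b₂ (Psi3 x) =
      ∑ j, connectionMatrix k j * algebraicBasis j x := by
  obtain ⟨r, hr, hball⟩ := exists_ball_isTameAt
  have hU : IsOpen (Metric.ball (0 : ℂ) r) := Metric.isOpen_ball
  have h₀ : (0 : ℂ) ∈ Metric.ball 0 r := Metric.mem_ball_self hr
  have ht (x) (hx : x ∈ Metric.ball (0 : ℂ) r) : IsTameAt x := (hball x hx).1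
  have hF {x} (hx : x ∈ Metric.ball (0 : ℂ) r) := analyticAt_hyp32_Psi3 (ht x hx)
    (-1 / 14 + k / 3) (3 / 14 + k / 3) (5 / 14 + k / 3) b₁ b₂
  have hp {x} (hx : x ∈ Metric.ball (0 : ℂ) r) := analyticAt_prefactor (ht x hx).P3_mem k
  have hy : AnalyticOnNhd ℂ (fun x => prefactor k x * hyp32 (-1 / 14 + k / 3) (3 / 14 + k / 3)
    (5 / 14 + k / 3) b₁ b₂ (Psi3 x)) (Metric.ball 0 r) := fun x hx => (hp hx).fun_mul (hF hx)
  refine (eqOn_linearCombination_of_iteratedDeriv_eq hU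
    (convex_ball 0 r).isPreconnected (analyticOnNhd_algebraicBasis hU ht) hy
    (fun x hx => (hball x hx).2) (fun x hx => (ht x hx).normalizedODE_last_eval_ne_zero)
    (fun x hx => isSolutionAt_algebraicBasis hU ht hx) (fun x hx => ?_) h₀
    fun i hi => ?_).eventuallyEq_of_mem (hU.mem_nhds h₀)
  · exact isSolutionAt_normalizedODE_of_forall_ne_zero hU hy (fun x hx hx₀ =>
      isSolutionAt_prefactor_mul_hyp32 (ht x hx) hx₀ hb₁ hb₂ hindicial) hx
  · rw [iteratedDeriv_mul_of_le_analyticOrderAt (hp h₀) (hF h₀)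
      (three_le_analyticOrderAt_hyp32_Psi3_sub_one _ _ _ _ _) hi]
    exact iteratedDeriv_prefactor_zero_eq_sum k ⟨i, hi⟩

theorem eventually_summable_hyp32_Psi3 (a₁ a₂ a₃ b₁ b₂ : ℂ) :
    ∀ᶠ x in 𝓝 0, Summable fun n : ℕ => hyp32Coeff a₁ a₂ a₃ b₁ b₂ n * Psi3 x ^ n :=
  eventually_isTameAt.mono fun _ hx => summable_hyp32 a₁ a₂ a₃ b₁ b₂ hx.norm_Psi3_lt_one

theorem eventually_sqrt_P3_mul_hyp32_eq : ∀ᶠ x in 𝓝 (0 : ℂ),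
    P3 x ^ (1 / 2 : ℂ) * hyp32 (-1 / 14) (3 / 14) (5 / 14) (1 / 3) (2 / 3) (Psi3 x) =
      (3 + s7) / 6 * (W1 x * Y1 x) + (3 - s7) / 6 * (W2 x * Y2 x) := by
  have h := eventually_prefactor_mul_hyp32_eq (k := 0) (b₁ := 1 / 3) (b₂ := 2 / 3)
    (add_natCast_ne_zero (by norm_num)) (add_natCast_ne_zero (by norm_num))
    (fun t => by norm_num; ring)
  filter_upwards [h] with x hx
  simpa [prefactor, connectionMatrix, algebraicBasis, Fin.sum_univ_three] using hx

theorem eventually_mul_Q3_mul_hyp32_eq : ∀ᶠ x in 𝓝 (0 : ℂ),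
    x * Q3 x * P3 x ^ (-11 / 6 : ℂ) *
        hyp32 (11 / 42) (23 / 42) (29 / 42) (2 / 3) (4 / 3) (Psi3 x) =
      1 / 2 * (x * Y0 x) - s7 / 6 * (W1 x * Y1 x) + s7 / 6 * (W2 x * Y2 x) := by
  have h := eventually_prefactor_mul_hyp32_eq (k := 1) (b₁ := 2 / 3) (b₂ := 4 / 3)
    (add_natCast_ne_zero (by norm_num)) (add_natCast_ne_zero (by norm_num))
    (fun t => by norm_num; ring)
  filter_upwards [h] with x hx
  simp only [prefactor, connectionMatrix, algebraicBasis, Fin.sum_univ_three, Matrix.of_apply,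
    Matrix.cons_val] at hx
  norm_num at hx
  rw [neg_div, hx]
  ring

theorem eventually_sq_mul_Q3_sq_mul_hyp32_eq : ∀ᶠ x in 𝓝 (0 : ℂ),
    x ^ 2 * Q3 x ^ 2 * P3 x ^ (-25 / 6 : ℂ) *
        hyp32 (25 / 42) (37 / 42) (43 / 42) (4 / 3) (5 / 3) (Psi3 x) =
      6 * (x * Y0 x) + 2 * s7 * (W1 x * Y1 x) - 2 * s7 * (W2 x * Y2 x) := by
  have h := eventually_prefactor_mul_hyp32_eq (k := 2) (b₁ := 4 / 3) (b₂ := 5 / 3)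
    (add_natCast_ne_zero (by norm_num)) (add_natCast_ne_zero (by norm_num))
    (fun t => by norm_num; ring)
  filter_upwards [h] with x hx
  simp only [prefactor, connectionMatrix, algebraicBasis, Fin.sum_univ_three, Matrix.of_apply,
    Matrix.cons_val] at hx
  norm_num at hx
  rw [← mul_pow, neg_div, hx]
  ring

end HypergeometricSolutions

end Darboux3B

end

theorem mainTheorem4 :
    -- the three hypergeometric series converge at `Ψ₃(x)` for `x` near `0`
    (∀ᶠ x in 𝓝 (0 : ℂ),
      Summable (fun n : ℕ =>
        Darboux3B.hyp32Coeff (-1 / 14) (3 / 14) (5 / 14) (1 / 3) (2 / 3) n *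
          Darboux3B.Psi3 x ^ n) ∧
      Summable (fun n : ℕ =>
        Darboux3B.hyp32Coeff (11 / 42) (23 / 42) (29 / 42) (2 / 3) (4 / 3) n *
          Darboux3B.Psi3 x ^ n) ∧
      Summable (fun n : ℕ =>
        Darboux3B.hyp32Coeff (25 / 42) (37 / 42) (43 / 42) (4 / 3) (5 / 3) n *
          Darboux3B.Psi3 x ^ n)) ∧
    -- the three identities
    (∀ᶠ x in 𝓝 (0 : ℂ),
      Darboux3B.P3 x ^ (1 / 2 : ℂ) *
          Darboux3B.hyp32 (-1 / 14) (3 / 14) (5 / 14) (1 / 3) (2 / 3) (Darboux3B.Psi3 x) =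
        (3 + Darboux3B.s7) / 6 * (Darboux3B.W1 x * Darboux3B.Y1 x) +
          (3 - Darboux3B.s7) / 6 * (Darboux3B.W2 x * Darboux3B.Y2 x)) ∧
    (∀ᶠ x in 𝓝 (0 : ℂ),
      x * Darboux3B.Q3 x * Darboux3B.P3 x ^ (-11 / 6 : ℂ) *
          Darboux3B.hyp32 (11 / 42) (23 / 42) (29 / 42) (2 / 3) (4 / 3) (Darboux3B.Psi3 x) =
        1 / 2 * (x * Darboux3B.Y0 x) -
          Darboux3B.s7 / 6 * (Darboux3B.W1 x * Darboux3B.Y1 x) +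
          Darboux3B.s7 / 6 * (Darboux3B.W2 x * Darboux3B.Y2 x)) ∧
    (∀ᶠ x in 𝓝 (0 : ℂ),
      x ^ 2 * Darboux3B.Q3 x ^ 2 * Darboux3B.P3 x ^ (-25 / 6 : ℂ) *
          Darboux3B.hyp32 (25 / 42) (37 / 42) (43 / 42) (4 / 3) (5 / 3) (Darboux3B.Psi3 x) =
        6 * (x * Darboux3B.Y0 x) +
          2 * Darboux3B.s7 * (Darboux3B.W1 x * Darboux3B.Y1 x) -
          2 * Darboux3B.s7 * (Darboux3B.W2 x * Darboux3B.Y2 x)) ∧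
    -- `x Y₀, W₁ Y₁, W₂ Y₂` is a solution basis of the pulled-back equation near `x = 0`
    Darboux3B.IsPullbackSolutionBasisNearZero (-1 / 14) (3 / 14) (5 / 14) (1 / 3) (2 / 3)
      (fun x => Darboux3B.P3 x ^ (1 / 2 : ℂ)) Darboux3B.Psi3
      ![fun x => x * Darboux3B.Y0 x,
        fun x => Darboux3B.W1 x * Darboux3B.Y1 x,
        fun x => Darboux3B.W2 x * Darboux3B.Y2 x] := by
  refine ⟨?_, Darboux3B.eventually_sqrt_P3_mul_hyp32_eq, Darboux3B.eventually_mul_Q3_mul_hyp32_eq,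
    Darboux3B.eventually_sq_mul_Q3_sq_mul_hyp32_eq,
    Darboux3B.isPullbackSolutionBasisNearZero_algebraicBasis⟩
  exact (Darboux3B.eventually_summable_hyp32_Psi3 _ _ _ _ _).and
    ((Darboux3B.eventually_summable_hyp32_Psi3 _ _ _ _ _).and
      (Darboux3B.eventually_summable_hyp32_Psi3 _ _ _ _ _))
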